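/- Let $k$ be a field, $n\ge 2$ an integer and $q\in k$ a primitive $n$-th root of unity. Let $R=U_n(q)=k\langle a,b\mid a^n=0,\ b^n=1,\ ba=qab\rangle$ be the Taft algebra (half quantum group), with coproduct $\Delta(a)=a\otimes b+1\otimes a$, $\Delta(b)=b\otimes b$ and counit $\varepsilon(a)=0$, $\varepsilon(b)=1$, and let $$D(R)=k\langle a,b,c,d\mid a^n=0=d^n,\ b^n=1=c^n,\ ba=qab,\ dc=qcd,\ db=qbd,\ bc=cb,\ ca=qac,\ da-qad=1-bc\rangle$$ be its Drinfeld double, in which $R$ is embedded via $a\mapsto a$, $b\mapsto b$. Let $R^+=\ker\varepsilon\subset R$, and let $Q=D(R)/R^+D(R)$, regarded as a right $R$-module. Let $r(U_n(q))$ be the Green ring of $R$: the abelian group generated by the isomorphism classes $[V]$ of finite-dimensional right $R$-modules modulo the relations $[V\oplus W]=[V]+[W]$, with product $[V][W]=[V\otimes W]$ (diagonal action through $\Delta$) and unit the class of the trivial module. For $i\in\mathbb Z$ put $e_i=\frac1n\sum_{j=0}^{n-1}q^{(i-1)j}b^j\in R$ and $P_i=e_iR$ (so $P_{i+n}=P_i$),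 let $J$ be the Jacobson radical of $R$, and put $M(\ell,i)=P_{\ell-i+1}J^{n-\ell}$ for $1\le\ell\le n$. In $r(U_n(q))$ let $$\alpha=[M(1,n-1)],\qquad x=[M(2,0)],$$ and define $u_1=1$, $u_2=x$ and $u_{\ell+1}=x\,u_\ell-\alpha\,u_{\ell-1}$ for $\ell\ge2$. Then $$[Q]=1+\alpha+\sum_{\ell=2}^{n-1}\bigl(\alpha^{\,n+1-\ell}+\alpha\bigr)u_\ell+\alpha\,u_n ,$$ that is, $[Q]=1+\alpha+(\alpha^{n-1}+\alpha)x+(\alpha^{n-2}+\alpha)u_3+\cdots+(\alpha^2+\alpha)u_{n-1}+\alpha u_n$ (for $n=2$ this reads $[Q]=1+\alpha+\alpha x$). -/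

import Mathlib

open scoped TensorProduct

universe u v

/-! ## Finite-dimensional right modules over a bialgebra -/

/-- A finite-dimensional right `H`-module over the field `k`; `act h v` is `v · h`. -/
structure RightMod (k : Type u) (H : Type v) [Field k] [Ring H] [Algebra k H] where
  carrier : Type u
  [addCommGroup : AddCommGroup carrier]
  [module : Module k carrier]
  [finite : FiniteDimensional k carrier]
  act : H →ₗ[k] (carrier →ₗ[k] carrier)
  act_one : ∀ v, act 1 v = v
  act_mul : ∀ g h v, act (g * h) v = act h (act g v)

namespace RightMod

attribute [instance] RightMod.addCommGroup RightMod.module RightMod.finite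

section Basic

variable {k : Type u} {H : Type v} [Field k] [Ring H] [Algebra k H]

/-- Isomorphism of right `H`-modules. -/
def Iso (V W : RightMod k H) : Prop :=
  ∃ e : V.carrier ≃ₗ[k] W.carrier, ∀ h v, e (V.act h v) = W.act h (e v)

theorem Iso.refl (V : RightMod k H) : Iso V V := ⟨LinearEquiv.refl k _, fun _ _ => rfl⟩

theorem Iso.symm {V W : RightMod k H} : Iso V W → Iso W V := by
  rintro ⟨e, he⟩
  refine ⟨e.symm, fun h v => ?_⟩
  rw [LinearEquiv.symm_apply_eq, he, LinearEquiv.apply_symm_apply]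

theorem Iso.trans {V W X : RightMod k H} : Iso V W → Iso W X → Iso V X := by
  rintro ⟨e, he⟩ ⟨f, hf⟩
  exact ⟨e.trans f, fun h v => by simp [he, hf]⟩

/-- Isomorphism classes of finite-dimensional right modules. -/
instance isoSetoid (k : Type u) (H : Type v) [Field k] [Ring H] [Algebra k H] :
    Setoid (RightMod k H) where
  r := Iso
  iseqv := ⟨Iso.refl, Iso.symm, Iso.trans⟩

/-- The right `H`-module given by Mathlib's right modules, i.e. modules over `Hᵐᵒᵖ`. -/
def ofModule (k : Type u) (H : Type v) [Field k] [Ring H] [Algebra k H]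
    (V : Type u) [AddCommGroup V] [Module k V] [Module Hᵐᵒᵖ V] [IsScalarTower k Hᵐᵒᵖ V]
    [FiniteDimensional k V] : RightMod k H where
  carrier := V
  act := (Algebra.lsmul k k V).toLinearMap ∘ₗ (MulOpposite.opLinearEquiv k).toLinearMap
  act_one v := by simp
  act_mul g h v := by simp

/-- Restriction of a right module along an algebra homomorphism. -/
def restrict {A : Type*} [Ring A] [Algebra k A] (f : A →ₐ[k] H) (V : RightMod k H) :
    RightMod k A where
  carrier := V.carrier
  act := V.act ∘ₗ f.toLinearMap
  act_one v := by simp [V.act_one]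
  act_mul g h v := by simp [V.act_mul]

end Basic

section TensorAction

variable {k : Type u} {H : Type v} [Field k] [Ring H] [Bialgebra k H]
variable {U V W V' W' : Type u} [AddCommGroup U] [Module k U] [AddCommGroup V] [Module k V]
  [AddCommGroup W] [Module k W] [AddCommGroup V'] [Module k V'] [AddCommGroup W'] [Module k W']

/-- The action of `H ⊗ H` on `V ⊗ W`: `(v ⊗ w) · (g ⊗ h) = v·g ⊗ w·h`. -/
def act₂ (α : H →ₗ[k] (V →ₗ[k] V)) (β : H →ₗ[k] (W →ₗ[k] W)) :
    H ⊗[k] H →ₗ[k] (V ⊗[k] W →ₗ[k] V ⊗[k] W) :=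
  (TensorProduct.homTensorHomMap (RingHom.id k) _ _ _ _) ∘ₗ (TensorProduct.map α β)

@[simp] theorem act₂_tmul (α : H →ₗ[k] (V →ₗ[k] V)) (β : H →ₗ[k] (W →ₗ[k] W))
    (g h : H) (v : V) (w : W) : act₂ α β (g ⊗ₜ h) (v ⊗ₜ w) = α g v ⊗ₜ β h w := by
  simp [act₂]

theorem act₂_mul (α : H →ₗ[k] (V →ₗ[k] V)) (β : H →ₗ[k] (W →ₗ[k] W))
    (hα : ∀ g h v, α (g * h) v = α h (α g v)) (hβ : ∀ g h w, β (g * h) w = β h (β g w))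
    (s t : H ⊗[k] H) (x : V ⊗[k] W) : act₂ α β (s * t) x = act₂ α β t (act₂ α β s x) := by
  induction x with
  | zero => simp
  | add x y hx hy => simp [hx, hy]
  | tmul v w =>
    induction s with
    | zero => simp
    | add x y hx hy => simp [add_mul, hx, hy]
    | tmul g h =>
      induction t with
      | zero => simp
      | add x y hx hy => simp [mul_add, hx, hy]
      | tmul g' h' => simp [hα, hβ]

theorem act₂_congr (α : H →ₗ[k] (V →ₗ[k] V)) (β : H →ₗ[k] (W →ₗ[k] W))
    (α' : H →ₗ[k] (V' →ₗ[k] V')) (β' : H →ₗ[k] (W' →ₗ[k] W'))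
    (e : V ≃ₗ[k] V') (f : W ≃ₗ[k] W') (he : ∀ h v, e (α h v) = α' h (e v))
    (hf : ∀ h w, f (β h w) = β' h (f w)) (t : H ⊗[k] H) (x : V ⊗[k] W) :
    TensorProduct.congr e f (act₂ α β t x) = act₂ α' β' t (TensorProduct.congr e f x) := by
  induction x with
  | zero => simp
  | add x y hx hy => simp only [map_add, hx, hy]
  | tmul v w =>
    induction t with
    | zero => simp
    | add x y hx hy => simp only [map_add, LinearMap.add_apply, hx, hy]
    | tmul g h => simp [he, hf]

/-- The action of `H ⊗ (H ⊗ H)` on `U ⊗ (V ⊗ W)`. -/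
def act₃ (α : H →ₗ[k] (U →ₗ[k] U)) (β : H →ₗ[k] (V →ₗ[k] V)) (γ : H →ₗ[k] (W →ₗ[k] W)) :
    H ⊗[k] (H ⊗[k] H) →ₗ[k] (U ⊗[k] (V ⊗[k] W) →ₗ[k] U ⊗[k] (V ⊗[k] W)) :=
  (TensorProduct.homTensorHomMap (RingHom.id k) _ _ _ _) ∘ₗ (TensorProduct.map α (act₂ β γ))

theorem act₃_left (α : H →ₗ[k] (U →ₗ[k] U)) (β : H →ₗ[k] (V →ₗ[k] V))
    (γ : H →ₗ[k] (W →ₗ[k] W)) (t : H ⊗[k] H) (u : U) (v : V) (w : W) :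
    TensorProduct.assoc k _ _ _
        (act₂ (act₂ α β ∘ₗ Coalgebra.comul) γ t ((u ⊗ₜ v) ⊗ₜ w)) =
      act₃ α β γ (TensorProduct.assoc k _ _ _ ((Coalgebra.comul (R := k)).rTensor H t))
        (u ⊗ₜ (v ⊗ₜ w)) := by
  induction t with
  | zero => simp
  | add x y hx hy => simp only [map_add, LinearMap.add_apply, hx, hy]
  | tmul g h =>
    rw [act₂_tmul, LinearMap.rTensor_tmul, LinearMap.comp_apply]
    generalize (Coalgebra.comul g : H ⊗[k] H) = s
    induction s with
    | zero => simp
    | add x y hx hy => simp only [map_add, LinearMap.add_apply, TensorProduct.add_tmul, hx, hy]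
    | tmul a b => simp [act₃]

theorem act₃_right (α : H →ₗ[k] (U →ₗ[k] U)) (β : H →ₗ[k] (V →ₗ[k] V))
    (γ : H →ₗ[k] (W →ₗ[k] W)) (t : H ⊗[k] H) (u : U) (v : V) (w : W) :
    act₂ α (act₂ β γ ∘ₗ Coalgebra.comul) t (u ⊗ₜ (v ⊗ₜ w)) =
      act₃ α β γ ((Coalgebra.comul (R := k)).lTensor H t) (u ⊗ₜ (v ⊗ₜ w)) := by
  induction t with
  | zero => simp
  | add x y hx hy => simp only [map_add, LinearMap.add_apply, hx, hy]
  | tmul g h => simp [act₃]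

theorem act₂_assoc (α : H →ₗ[k] (U →ₗ[k] U)) (β : H →ₗ[k] (V →ₗ[k] V))
    (γ : H →ₗ[k] (W →ₗ[k] W)) (h : H) (x : (U ⊗[k] V) ⊗[k] W) :
    TensorProduct.assoc k _ _ _
        (act₂ (act₂ α β ∘ₗ Coalgebra.comul) γ (Coalgebra.comul h) x) =
      act₂ α (act₂ β γ ∘ₗ Coalgebra.comul) (Coalgebra.comul h)
        (TensorProduct.assoc k _ _ _ x) := by
  induction x with
  | zero => simp
  | add x y hx hy => simp only [map_add, hx, hy]
  | tmul y w =>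
    induction y with
    | zero => simp
    | add x y hx hy => simp only [TensorProduct.add_tmul, map_add, hx, hy]
    | tmul u v =>
      rw [act₃_left, TensorProduct.assoc_tmul, act₃_right, Coalgebra.coassoc_apply]

theorem act₂_lid (β : H →ₗ[k] (V →ₗ[k] V)) (h : H) (x : k ⊗[k] V) :
    TensorProduct.lid k _
        (act₂ (LinearMap.lsmul k k ∘ₗ Coalgebra.counit) β (Coalgebra.comul h) x) =
      β h (TensorProduct.lid k _ x) := by
  have h1 : ∀ (t : H ⊗[k] H) (c : k) (v : V),
      TensorProduct.lid k _ (act₂ (LinearMap.lsmul k k ∘ₗ Coalgebra.counit) β t (c ⊗ₜ v)) =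
        β (TensorProduct.lid k _ ((Coalgebra.counit (R := k)).rTensor H t)) (c • v) := by
    intro t c v
    induction t with
    | zero => simp
    | add x y hx hy => simp only [map_add, LinearMap.add_apply, hx, hy]
    | tmul g h => simp [smul_smul, mul_comm]
  induction x with
  | zero => simp
  | add x y hx hy => simp only [map_add, hx, hy]
  | tmul c v => rw [h1, Coalgebra.rTensor_counit_comul]; simp

theorem act₂_rid (β : H →ₗ[k] (V →ₗ[k] V)) (h : H) (x : V ⊗[k] k) :
    TensorProduct.rid k _
        (act₂ β (LinearMap.lsmul k k ∘ₗ Coalgebra.counit) (Coalgebra.comul h) x) =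
      β h (TensorProduct.rid k _ x) := by
  have h1 : ∀ (t : H ⊗[k] H) (c : k) (v : V),
      TensorProduct.rid k _ (act₂ β (LinearMap.lsmul k k ∘ₗ Coalgebra.counit) t (v ⊗ₜ c)) =
        β (TensorProduct.rid k _ ((Coalgebra.counit (R := k)).lTensor H t)) (c • v) := by
    intro t c v
    induction t with
    | zero => simp
    | add x y hx hy => simp only [map_add, LinearMap.add_apply, hx, hy]
    | tmul g h => simp [smul_smul, mul_comm]
  induction x with
  | zero => simp
  | add x y hx hy => simp only [map_add, hx, hy]
  | tmul v c => rw [h1, Coalgebra.lTensor_counit_comul]; simp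

/-- The componentwise action on `V × W`. -/
def prodAct (α : H →ₗ[k] (V →ₗ[k] V)) (β : H →ₗ[k] (W →ₗ[k] W)) :
    H →ₗ[k] (V × W →ₗ[k] V × W) where
  toFun h := (α h).prodMap (β h)
  map_add' g h := by ext <;> simp
  map_smul' c h := by ext <;> simp

@[simp] theorem prodAct_apply (α : H →ₗ[k] (V →ₗ[k] V)) (β : H →ₗ[k] (W →ₗ[k] W)) (h : H)
    (x : V × W) : prodAct α β h x = (α h x.1, β h x.2) := rfl

theorem act₂_prodRight (α : H →ₗ[k] (U →ₗ[k] U)) (β : H →ₗ[k] (V →ₗ[k] V))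
    (γ : H →ₗ[k] (W →ₗ[k] W)) (t : H ⊗[k] H) (x : U ⊗[k] (V × W)) :
    TensorProduct.prodRight k k _ _ _ (act₂ α (prodAct β γ) t x) =
      (act₂ α β t (TensorProduct.prodRight k k _ _ _ x).1,
        act₂ α γ t (TensorProduct.prodRight k k _ _ _ x).2) := by
  induction x with
  | zero => simp; rfl
  | add x y hx hy => simp only [map_add, hx, hy, Prod.fst_add, Prod.snd_add, Prod.mk_add_mk]
  | tmul v w =>
    induction t with
    | zero => simp; rfl
    | add x y hx hy => simp only [map_add, LinearMap.add_apply, hx, hy, Prod.mk_add_mk]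
    | tmul g h => simp

theorem act₂_prodLeft (α : H →ₗ[k] (U →ₗ[k] U)) (β : H →ₗ[k] (V →ₗ[k] V))
    (γ : H →ₗ[k] (W →ₗ[k] W)) (t : H ⊗[k] H) (x : (U × V) ⊗[k] W) :
    TensorProduct.prodLeft k k _ _ _ (act₂ (prodAct α β) γ t x) =
      (act₂ α γ t (TensorProduct.prodLeft k k _ _ _ x).1,
        act₂ β γ t (TensorProduct.prodLeft k k _ _ _ x).2) := by
  induction x with
  | zero => simp; rfl
  | add x y hx hy => simp only [map_add, hx, hy, Prod.fst_add, Prod.snd_add, Prod.mk_add_mk]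
  | tmul v w =>
    induction t with
    | zero => simp; rfl
    | add x y hx hy => simp only [map_add, LinearMap.add_apply, hx, hy, Prod.mk_add_mk]
    | tmul g h => obtain ⟨u, v⟩ := v; simp

end TensorAction

section Tensor

variable {k : Type u} {H : Type v} [Field k] [Ring H] [Bialgebra k H]

/-- The direct sum `V ⊕ W`. -/
def prod (V W : RightMod k H) : RightMod k H where
  carrier := V.carrier × W.carrier
  act := prodAct V.act W.act
  act_one v := by simp [V.act_one, W.act_one]
  act_mul g h v := by simp [V.act_mul, W.act_mul]

/-- The tensor product `V ⊗ W` with the diagonal action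
`(v ⊗ w) · h = v·h₍₁₎ ⊗ w·h₍₂₎`. -/
def tensor (V W : RightMod k H) : RightMod k H where
  carrier := V.carrier ⊗[k] W.carrier
  act := act₂ V.act W.act ∘ₗ Coalgebra.comul
  act_one x := by
    induction x with
    | zero => simp
    | add x y hx hy => rw [map_add, hx, hy]
    | tmul v w => simp [Algebra.TensorProduct.one_def, V.act_one, W.act_one]
  act_mul g h x := by simp [act₂_mul _ _ V.act_mul W.act_mul]

/-- The trivial module `k`, with `v · h = ε(h) v`. -/
def unit (k : Type u) (H : Type v) [Field k] [Ring H] [Bialgebra k H] : RightMod k H where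
  carrier := k
  act := LinearMap.lsmul k k ∘ₗ Coalgebra.counit
  act_one v := by simp
  act_mul g h v := by simp [mul_comm, mul_left_comm]

theorem prod_iso {V V' W W' : RightMod k H} :
    Iso V V' → Iso W W' → Iso (prod V W) (prod V' W') := by
  rintro ⟨e, he⟩ ⟨f, hf⟩
  exact ⟨e.prodCongr f, fun h v => Prod.ext (he h v.1) (hf h v.2)⟩

theorem tensor_iso {V V' W W' : RightMod k H} :
    Iso V V' → Iso W W' → Iso (tensor V W) (tensor V' W') := by
  rintro ⟨e, he⟩ ⟨f, hf⟩
  exact ⟨TensorProduct.congr e f, fun _ x => act₂_congr _ _ _ _ e f he hf _ x⟩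

theorem tensor_assoc (U V W : RightMod k H) :
    Iso (tensor (tensor U V) W) (tensor U (tensor V W)) :=
  ⟨TensorProduct.assoc k _ _ _, fun h x => act₂_assoc U.act V.act W.act h x⟩

theorem unit_tensor (V : RightMod k H) : Iso (tensor (unit k H) V) V :=
  ⟨TensorProduct.lid k _, fun h x => act₂_lid V.act h x⟩

theorem tensor_unit (V : RightMod k H) : Iso (tensor V (unit k H)) V :=
  ⟨TensorProduct.rid k _, fun h x => act₂_rid V.act h x⟩

theorem tensor_prod (U V W : RightMod k H) :
    Iso (tensor U (prod V W)) (prod (tensor U V) (tensor U W)) :=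
  ⟨TensorProduct.prodRight k k _ _ _, fun _ x => act₂_prodRight U.act V.act W.act _ x⟩

theorem prod_tensor (U V W : RightMod k H) :
    Iso (tensor (prod U V) W) (prod (tensor U W) (tensor V W)) :=
  ⟨TensorProduct.prodLeft k k _ _ _, fun _ x => act₂_prodLeft U.act V.act W.act _ x⟩

end Tensor

end RightMod

/-! ## The Green ring -/

/-- Isomorphism classes of finite-dimensional right `H`-modules. -/
def IsoClass (k : Type u) (H : Type v) [Field k] [Ring H] [Algebra k H] : Type (max (u + 1) v) :=
  Quotient (RightMod.isoSetoid k H)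

namespace IsoClass

variable {k : Type u} {H : Type v} [Field k] [Ring H] [Bialgebra k H]

/-- The isomorphism class of `V`. -/
def mk (V : RightMod k H) : IsoClass k H := Quotient.mk _ V

theorem mk_surjective : Function.Surjective (mk : RightMod k H → IsoClass k H) :=
  Quotient.exists_rep

/-- Isomorphism classes form a monoid under the tensor product. -/
instance : Monoid (IsoClass k H) where
  mul := Quotient.map₂ RightMod.tensor fun _ _ h _ _ h' => RightMod.tensor_iso h h'
  one := mk (RightMod.unit k H)
  mul_assoc := by
    rintro ⟨U⟩ ⟨V⟩ ⟨W⟩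
    exact Quotient.sound (RightMod.tensor_assoc U V W)
  one_mul := by
    rintro ⟨V⟩
    exact Quotient.sound (RightMod.unit_tensor V)
  mul_one := by
    rintro ⟨V⟩
    exact Quotient.sound (RightMod.tensor_unit V)

end IsoClass

section GreenRing

variable (k : Type u) (H : Type v) [Field k] [Ring H] [Bialgebra k H]

/-- The subgroup of the free abelian group on the isomorphism classes that is generated by the
elements `[V ⊕ W] - [V] - [W]`. -/
def directSumRelations : AddSubgroup (FreeAbelianGroup (IsoClass k H)) :=
  AddSubgroup.closure (Set.range fun p : RightMod k H × RightMod k H =>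
    FreeAbelianGroup.of (IsoClass.mk (p.1.prod p.2)) -
      FreeAbelianGroup.of (IsoClass.mk p.1) - FreeAbelianGroup.of (IsoClass.mk p.2))

theorem directSumRelations_mul_left (x y : FreeAbelianGroup (IsoClass k H))
    (hy : y ∈ directSumRelations k H) : x * y ∈ directSumRelations k H := by
  induction x using FreeAbelianGroup.induction_on with
  | zero => simp
  | neg x h => simpa using h
  | add x x' h h' => rw [add_mul]; exact add_mem h h'
  | of c =>
    obtain ⟨U, rfl⟩ := IsoClass.mk_surjective c
    induction hy using AddSubgroup.closure_induction with
    | zero => simp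
    | neg x _ h => rw [mul_neg]; exact neg_mem h
    | add x y _ _ h h' => rw [mul_add]; exact add_mem h h'
    | mem y hy =>
      obtain ⟨⟨V, W⟩, rfl⟩ := hy
      have e : IsoClass.mk U * IsoClass.mk (V.prod W) =
          IsoClass.mk ((U.tensor V).prod (U.tensor W)) :=
        Quotient.sound (RightMod.tensor_prod U V W)
      refine AddSubgroup.subset_closure ⟨(U.tensor V, U.tensor W), ?_⟩
      rw [mul_sub, mul_sub, FreeAbelianGroup.of_mul_of, FreeAbelianGroup.of_mul_of,
        FreeAbelianGroup.of_mul_of]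
      rw [e]
      rfl

theorem directSumRelations_mul_right (x y : FreeAbelianGroup (IsoClass k H))
    (hx : x ∈ directSumRelations k H) : x * y ∈ directSumRelations k H := by
  induction y using FreeAbelianGroup.induction_on with
  | zero => simp
  | neg x h => simpa using h
  | add x x' h h' => rw [mul_add]; exact add_mem h h'
  | of c =>
    obtain ⟨W, rfl⟩ := IsoClass.mk_surjective c
    induction hx using AddSubgroup.closure_induction with
    | zero => simp
    | neg x _ h => rw [neg_mul]; exact neg_mem h
    | add x y _ _ h h' => rw [add_mul]; exact add_mem h h'
    | mem y hy =>
      obtain ⟨⟨U, V⟩, rfl⟩ := hy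
      have e : IsoClass.mk (U.prod V) * IsoClass.mk W =
          IsoClass.mk ((U.tensor W).prod (V.tensor W)) :=
        Quotient.sound (RightMod.prod_tensor U V W)
      refine AddSubgroup.subset_closure ⟨(U.tensor W, V.tensor W), ?_⟩
      rw [sub_mul, sub_mul, FreeAbelianGroup.of_mul_of, FreeAbelianGroup.of_mul_of,
        FreeAbelianGroup.of_mul_of]
      rw [e]
      rfl

/-- The subgroup of direct sum relations is a two-sided ideal for the tensor product. -/
def directSumIdeal : TwoSidedIdeal (FreeAbelianGroup (IsoClass k H)) :=
  TwoSidedIdeal.mk' (directSumRelations k H : Set (FreeAbelianGroup (IsoClass k H)))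
    (zero_mem _) add_mem neg_mem (directSumRelations_mul_left k H _ _)
    (directSumRelations_mul_right k H _ _)

/-- The Green ring `r(H)`: the free abelian group on the isomorphism classes of
finite-dimensional right `H`-modules modulo `[V ⊕ W] = [V] + [W]`, with multiplication
`[V][W] = [V ⊗ W]` and unit element the class of the trivial module. -/
def GreenRing : Type (max (u + 1) v) := (directSumIdeal k H).ringCon.Quotient

instance : Ring (GreenRing k H) :=
  inferInstanceAs (Ring (directSumIdeal k H).ringCon.Quotient)

variable {k H}

/-- The class `[V]` in the Green ring. -/
def GreenRing.cls (V : RightMod k H) : GreenRing k H :=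
  (directSumIdeal k H).ringCon.mk' (FreeAbelianGroup.of (IsoClass.mk V))

theorem GreenRing.cls_eq_of_iso {V W : RightMod k H} (h : RightMod.Iso V W) :
    GreenRing.cls V = GreenRing.cls W := by
  have e : IsoClass.mk V = IsoClass.mk W := Quotient.sound h
  rw [GreenRing.cls, GreenRing.cls, e]

theorem GreenRing.cls_prod (V W : RightMod k H) :
    GreenRing.cls (V.prod W) = GreenRing.cls V + GreenRing.cls W := by
  have h : (directSumIdeal k H).ringCon (FreeAbelianGroup.of (IsoClass.mk (V.prod W)))
      (FreeAbelianGroup.of (IsoClass.mk V) + FreeAbelianGroup.of (IsoClass.mk W)) := by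
    rw [TwoSidedIdeal.rel_iff, directSumIdeal, TwoSidedIdeal.mem_mk', ← sub_sub]
    exact AddSubgroup.subset_closure ⟨(V, W), rfl⟩
  exact Quotient.sound h

theorem GreenRing.cls_tensor (V W : RightMod k H) :
    GreenRing.cls (V.tensor W) = GreenRing.cls V * GreenRing.cls W := by
  have e : IsoClass.mk (V.tensor W) = IsoClass.mk V * IsoClass.mk W := rfl
  rw [GreenRing.cls, e, ← FreeAbelianGroup.of_mul_of]
  rfl

theorem GreenRing.cls_unit : GreenRing.cls (RightMod.unit k H) = 1 := rfl

end GreenRing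

/-! ## The Taft algebra -/

section QBinomial

variable {k : Type u} [Field k]

/-- Gaussian binomial coefficients. -/
def qChoose (q : k) : ℕ → ℕ → k
  | _, 0 => 1
  | 0, _ + 1 => 0
  | m + 1, j + 1 => q ^ (j + 1) * qChoose q m (j + 1) + qChoose q m j

theorem qChoose_rec (q : k) (m j : ℕ) :
    (q ^ (j + 1) - 1) * q ^ j * qChoose q m (j + 1) = (q ^ m - q ^ j) * qChoose q m j := by
  induction m generalizing j with
  | zero => cases j <;> simp [qChoose]
  | succ m ih =>
    cases j with
    | zero =>
      have h := ih 0
      simp only [qChoose, pow_zero, zero_add, pow_one, mul_one] at h ⊢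
      linear_combination q * h
    | succ j =>
      have h1 := ih j
      have h2 := ih (j + 1)
      simp only [qChoose]
      linear_combination q ^ (j + 2) * h2 + q * h1

theorem qChoose_eq_zero {q : k} {n : ℕ} (hq : IsPrimitiveRoot q n) (j : ℕ) (hj : j + 1 < n) :
    qChoose q n (j + 1) = 0 := by
  have hn : n ≠ 0 := by omega
  have h0 : q ≠ 0 := hq.ne_zero hn
  have h1 : q ^ (j + 1) - 1 ≠ 0 := sub_ne_zero.2 (hq.pow_ne_one_of_pos_of_lt (by omega) hj)
  have key := qChoose_rec q n j
  suffices h : (q ^ n - q ^ j) * qChoose q n j = 0 by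
    rw [h] at key
    exact (mul_eq_zero.1 key).resolve_left (mul_ne_zero h1 (pow_ne_zero _ h0))
  cases j with
  | zero => simp [hq.pow_eq_one]
  | succ j => rw [qChoose_eq_zero hq j (by omega), mul_zero]

theorem qAdd_pow {A : Type*} [Ring A] [Algebra k A] (q : k) (x y : A)
    (h : x * y = q • (y * x)) (m : ℕ) :
    (x + y) ^ m = ∑ j ∈ Finset.range (m + 1), qChoose q m j • (y ^ j * x ^ (m - j)) := by
  have hx : ∀ j : ℕ, x * y ^ j = q ^ j • (y ^ j * x) := by
    intro j
    induction j with
    | zero => simp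
    | succ j ih =>
      rw [pow_succ, ← mul_assoc, ih, smul_mul_assoc, mul_assoc, h, mul_smul_comm, smul_smul,
        mul_assoc, pow_succ]
  have hvan : ∀ m j : ℕ, m < j → qChoose q m j = 0 := by
    intro m
    induction m with
    | zero => intro j hj; obtain ⟨j, rfl⟩ := Nat.exists_eq_succ_of_ne_zero hj.ne'; rfl
    | succ m ih =>
      intro j hj
      obtain ⟨j, rfl⟩ := Nat.exists_eq_succ_of_ne_zero (Nat.ne_zero_of_lt hj)
      simp [qChoose, ih (j + 1) (by omega), ih j (by omega)]
  induction m with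
  | zero => simp [qChoose]
  | succ m ih =>
    rw [pow_succ', ih, add_mul, Finset.mul_sum, Finset.mul_sum, Finset.sum_range_succ' _ (m + 1)]
    have e1 : ∀ j ∈ Finset.range (m + 1),
        qChoose q (m + 1) (j + 1) • (y ^ (j + 1) * x ^ (m + 1 - (j + 1))) =
          x * (qChoose q m (j + 1) • (y ^ (j + 1) * x ^ (m - (j + 1)))) +
          y * (qChoose q m j • (y ^ j * x ^ (m - j))) := by
      intro j hj
      have hj' := Finset.mem_range.1 hj
      rw [mul_smul_comm, mul_smul_comm, ← mul_assoc x, hx, ← mul_assoc y, ← pow_succ',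
        smul_mul_assoc, smul_smul, qChoose, add_smul, mul_comm (q ^ (j + 1)),
        Nat.add_sub_add_right, mul_assoc (y ^ (j + 1)) x, ← pow_succ']
      rcases Nat.lt_or_ge j m with hlt | hge
      · rw [show m - (j + 1) + 1 = m - j by omega]
      · rw [hvan m (j + 1) (by omega)]; simp
    rw [Finset.sum_congr rfl e1, Finset.sum_add_distrib, add_right_comm]
    congr 1
    rw [Finset.sum_range_succ' _ m, Finset.sum_range_succ _ m, hvan m (m + 1) (by omega)]
    simp [qChoose, pow_succ']

theorem qAdd_pow_eq_zero {A : Type*} [Ring A] [Algebra k A] {q : k} {n : ℕ}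
    (hq : IsPrimitiveRoot q n) (x y : A) (h : x * y = q • (y * x)) (hx : x ^ n = 0)
    (hy : y ^ n = 0) : (x + y) ^ n = 0 := by
  rw [qAdd_pow q x y h]
  refine Finset.sum_eq_zero fun j hj => ?_
  have hj' := Finset.mem_range.1 hj
  rcases j with _ | j
  · simp [hx]
  · rcases Nat.lt_or_ge (j + 1) n with h1 | h1
    · rw [qChoose_eq_zero hq j h1, zero_smul]
    · rw [show j + 1 = n by omega, hy, zero_mul, smul_zero]

end QBinomial

/-- The two generators of the Taft algebra. -/
inductive TaftGen
  | a
  | b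

/-- The relations `aⁿ = 0`, `bⁿ = 1`, `ba = qab`. -/
inductive TaftRel {k : Type u} [Field k] (n : ℕ) (q : k) :
    FreeAlgebra k TaftGen → FreeAlgebra k TaftGen → Prop
  | a_pow : TaftRel n q (FreeAlgebra.ι k TaftGen.a ^ n) 0
  | b_pow : TaftRel n q (FreeAlgebra.ι k TaftGen.b ^ n) 1
  | b_mul_a : TaftRel n q (FreeAlgebra.ι k TaftGen.b * FreeAlgebra.ι k TaftGen.a)
      (q • (FreeAlgebra.ι k TaftGen.a * FreeAlgebra.ι k TaftGen.b))

/-- The half quantum group (Taft algebra) `Uₙ(q) = k⟨a, b | aⁿ = 0, bⁿ = 1, ba = qab⟩`. -/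
def Taft {k : Type u} [Field k] (n : ℕ) (q : k) : Type u := RingQuot (TaftRel n q)

namespace Taft

section

variable {k : Type u} [Field k] (n : ℕ) (q : k)

instance : Ring (Taft n q) := inferInstanceAs (Ring (RingQuot (TaftRel n q)))

instance : Algebra k (Taft n q) := inferInstanceAs (Algebra k (RingQuot (TaftRel n q)))

/-- The quotient map from the free algebra. -/
def mkHom : FreeAlgebra k TaftGen →ₐ[k] Taft n q := RingQuot.mkAlgHom k (TaftRel n q)

/-- The generator `a`. -/
def a : Taft n q := mkHom n q (FreeAlgebra.ι k TaftGen.a)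

/-- The generator `b`. -/
def b : Taft n q := mkHom n q (FreeAlgebra.ι k TaftGen.b)

theorem a_pow : a n q ^ n = 0 := by
  rw [a, ← map_pow, ← map_zero (mkHom n q)]
  exact RingQuot.mkAlgHom_rel k TaftRel.a_pow

theorem b_pow : b n q ^ n = 1 := by
  rw [b, ← map_pow, ← map_one (mkHom n q)]
  exact RingQuot.mkAlgHom_rel k TaftRel.b_pow

theorem b_mul_a : b n q * a n q = q • (a n q * b n q) := by
  rw [a, b, ← map_mul, ← map_mul, ← map_smul]
  exact RingQuot.mkAlgHom_rel k TaftRel.b_mul_a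

variable {n q}

/-- The universal property of the Taft algebra. -/
def lift {A : Type*} [Ring A] [Algebra k A] (x y : A) (hx : x ^ n = 0) (hy : y ^ n = 1)
    (hyx : y * x = q • (x * y)) : Taft n q →ₐ[k] A :=
  RingQuot.liftAlgHom k ⟨FreeAlgebra.lift k fun g => match g with
    | TaftGen.a => x
    | TaftGen.b => y, by rintro _ _ (_ | _ | _) <;> simp [hx, hy, hyx]⟩

@[simp] theorem lift_a {A : Type*} [Ring A] [Algebra k A] (x y : A) (hx : x ^ n = 0)
    (hy : y ^ n = 1) (hyx : y * x = q • (x * y)) : lift x y hx hy hyx (a n q) = x := by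
  exact (RingQuot.liftAlgHom_mkAlgHom_apply k _ _ _).trans (FreeAlgebra.lift_ι_apply _ _)

@[simp] theorem lift_b {A : Type*} [Ring A] [Algebra k A] (x y : A) (hx : x ^ n = 0)
    (hy : y ^ n = 1) (hyx : y * x = q • (x * y)) : lift x y hx hy hyx (b n q) = y := by
  exact (RingQuot.liftAlgHom_mkAlgHom_apply k _ _ _).trans (FreeAlgebra.lift_ι_apply _ _)

theorem algHom_ext {A : Type*} [Ring A] [Algebra k A] {f g : Taft n q →ₐ[k] A}
    (ha : f (a n q) = g (a n q)) (hb : f (b n q) = g (b n q)) : f = g := by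
  refine RingQuot.ringQuot_ext' k f g (FreeAlgebra.hom_ext (funext fun t => ?_))
  cases t
  · exact ha
  · exact hb

end

section Bialgebra

variable {k : Type u} [Field k] (n : ℕ) (q : k) [hn : Fact (2 ≤ n)]

/-- The counit `ε(a) = 0`, `ε(b) = 1`. -/
def counitHom : Taft n q →ₐ[k] k :=
  lift 0 1 (zero_pow (by have := hn.out; omega)) (one_pow n) (by simp)

variable [hq : Fact (IsPrimitiveRoot q n)]

/-- The comultiplication `Δ(a) = a ⊗ b + 1 ⊗ a`, `Δ(b) = b ⊗ b`. -/
def comulHom : Taft n q →ₐ[k] Taft n q ⊗[k] Taft n q :=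
  lift (a n q ⊗ₜ b n q + 1 ⊗ₜ a n q) (b n q ⊗ₜ b n q)
    (by
      refine qAdd_pow_eq_zero hq.out _ _ ?_ ?_ ?_
      · simp [Algebra.TensorProduct.tmul_mul_tmul, b_mul_a]
      · simp [Algebra.TensorProduct.tmul_pow, a_pow]
      · simp [Algebra.TensorProduct.tmul_pow, a_pow])
    (by simp [Algebra.TensorProduct.tmul_pow, b_pow, Algebra.TensorProduct.one_def])
    (by
      simp [mul_add, add_mul, Algebra.TensorProduct.tmul_mul_tmul, b_mul_a,
        TensorProduct.smul_tmul'])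

instance : Bialgebra k (Taft n q) :=
  Bialgebra.ofAlgHom (comulHom n q) (counitHom n q)
    (by
      apply algHom_ext <;>
      simp [comulHom, TensorProduct.add_tmul, TensorProduct.tmul_add,
        Algebra.TensorProduct.one_def, add_assoc])
    (by
      apply algHom_ext <;> simp [comulHom, counitHom])
    (by
      apply algHom_ext <;> simp [comulHom, counitHom])

end Bialgebra

section Modules

variable {k : Type u} [Field k] (n : ℕ) (q : k)

theorem span_eq_top [hn : Fact (2 ≤ n)] :
    Submodule.span k (Set.range fun p : Fin n × Fin n =>
      a n q ^ (p.1 : ℕ) * b n q ^ (p.2 : ℕ)) = ⊤ := by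
  have hpos : 0 < n := by have := hn.out; omega
  set S := Submodule.span k (Set.range fun p : Fin n × Fin n =>
      a n q ^ (p.1 : ℕ) * b n q ^ (p.2 : ℕ)) with hS
  have hmem : ∀ i j : ℕ, a n q ^ i * b n q ^ j ∈ S := by
    intro i j
    rw [pow_eq_pow_mod j (b_pow n q)]
    rcases Nat.lt_or_ge i n with hi | hi
    · exact Submodule.subset_span ⟨(⟨i, hi⟩, ⟨j % n, Nat.mod_lt _ hpos⟩), rfl⟩
    · rw [pow_eq_zero_of_le hi (a_pow n q), zero_mul]
      exact zero_mem _
  have hba : ∀ i : ℕ, b n q * a n q ^ i = q ^ i • (a n q ^ i * b n q) := by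
    intro i
    induction i with
    | zero => simp
    | succ i ih =>
      rw [pow_succ, ← mul_assoc, ih, smul_mul_assoc, mul_assoc, b_mul_a, mul_smul_comm,
        smul_smul, mul_assoc, pow_succ]
  have key : ∀ (y : FreeAlgebra k TaftGen) (s : Taft n q), s ∈ S → mkHom n q y * s ∈ S := by
    intro y
    induction y using FreeAlgebra.induction with
    | grade0 r =>
      intro s hs
      rw [AlgHom.commutes, ← Algebra.smul_def]
      exact S.smul_mem r hs
    | mul x y hx hy =>
      intro s hs
      rw [map_mul, mul_assoc]
      exact hx _ (hy _ hs)
    | add x y hx hy =>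
      intro s hs
      rw [map_add, add_mul]
      exact add_mem (hx _ hs) (hy _ hs)
    | grade1 t =>
      intro s hs
      induction hs using Submodule.span_induction with
      | zero => simp
      | add x y _ _ hx hy => rw [mul_add]; exact add_mem hx hy
      | smul r x _ hx => rw [mul_smul_comm]; exact S.smul_mem r hx
      | mem x hx =>
        obtain ⟨⟨i, j⟩, rfl⟩ := hx
        cases t with
        | a =>
          change a n q * (a n q ^ (i : ℕ) * b n q ^ (j : ℕ)) ∈ S
          rw [← mul_assoc, ← pow_succ']
          exact hmem _ _
        | b =>
          change b n q * (a n q ^ (i : ℕ) * b n q ^ (j : ℕ)) ∈ S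
          rw [← mul_assoc, hba, smul_mul_assoc, mul_assoc, ← pow_succ']
          exact S.smul_mem _ (hmem _ _)
  refine eq_top_iff.2 fun x _ => ?_
  obtain ⟨y, rfl⟩ := RingQuot.mkAlgHom_surjective k (TaftRel n q) x
  have h1 : (1 : Taft n q) ∈ S := by simpa using hmem 0 0
  have h2 := key y 1 h1
  rw [mul_one] at h2
  exact h2

instance [hn : Fact (2 ≤ n)] : FiniteDimensional k (Taft n q) :=
  ⟨by rw [← span_eq_top n q]; exact Submodule.fg_span (Set.finite_range _)⟩

/-- The idempotent `eᵢ = (1/n) ∑ⱼ q^((i-1)j) bʲ`, which depends only on `i` modulo `n`. -/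
def idem (i : ℤ) : Taft n q :=
  (n : k)⁻¹ • ∑ j ∈ Finset.range n, q ^ ((i - 1) * (j : ℤ)) • b n q ^ j

/-- The principal right module `Pᵢ = eᵢ Uₙ(q)`. -/
def P (i : ℤ) : Submodule (Taft n q)ᵐᵒᵖ (Taft n q) :=
  Submodule.span (Taft n q)ᵐᵒᵖ {idem n q i}

/-- The right module `Pᵢ Jʳ`, where right modules are modules over the opposite ring and `J` is the Jacobson radical of `Uₙ(q)`. -/
def PJ (i : ℤ) (r : ℕ) : Submodule (Taft n q)ᵐᵒᵖ (Taft n q) :=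
  Ring.jacobson (Taft n q)ᵐᵒᵖ ^ r • P n q i

instance [Fact (2 ≤ n)] (i : ℤ) (r : ℕ) : FiniteDimensional k (PJ n q i r) :=
  inferInstanceAs (FiniteDimensional k ((PJ n q i r).restrictScalars k))

/-- The indecomposable right module `M(ℓ, i) = P_{ℓ-i+1} J^{n-ℓ}`, for `1 ≤ ℓ ≤ n`
and `i` modulo `n`. -/
def M [Fact (2 ≤ n)] (l : ℕ) (i : ℤ) : RightMod k (Taft n q) :=
  RightMod.ofModule k (Taft n q) (PJ n q ((l : ℤ) - i + 1) (n - l))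

end Modules

end Taft

/-! ## The Drinfeld double and the quotient module -/

/-- The four generators of the Drinfeld double. -/
inductive DoubleGen
  | a
  | b
  | c
  | d

section

open DoubleGen

/-- The relations `aⁿ = 0 = dⁿ`, `bⁿ = 1 = cⁿ`, `ba = qab`, `dc = qcd`, `db = qbd`, `bc = cb`,
`ca = qac`, `da - qad = 1 - bc`. -/
inductive DoubleRel {k : Type u} [Field k] (n : ℕ) (q : k) :
    FreeAlgebra k DoubleGen → FreeAlgebra k DoubleGen → Prop
  | a_pow : DoubleRel n q (FreeAlgebra.ι k a ^ n) 0
  | b_pow : DoubleRel n q (FreeAlgebra.ι k b ^ n) 1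
  | c_pow : DoubleRel n q (FreeAlgebra.ι k c ^ n) 1
  | d_pow : DoubleRel n q (FreeAlgebra.ι k d ^ n) 0
  | b_mul_a : DoubleRel n q (FreeAlgebra.ι k b * FreeAlgebra.ι k a)
      (q • (FreeAlgebra.ι k a * FreeAlgebra.ι k b))
  | d_mul_c : DoubleRel n q (FreeAlgebra.ι k d * FreeAlgebra.ι k c)
      (q • (FreeAlgebra.ι k c * FreeAlgebra.ι k d))
  | d_mul_b : DoubleRel n q (FreeAlgebra.ι k d * FreeAlgebra.ι k b)
      (q • (FreeAlgebra.ι k b * FreeAlgebra.ι k d))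
  | b_mul_c : DoubleRel n q (FreeAlgebra.ι k b * FreeAlgebra.ι k c)
      (FreeAlgebra.ι k c * FreeAlgebra.ι k b)
  | c_mul_a : DoubleRel n q (FreeAlgebra.ι k c * FreeAlgebra.ι k a)
      (q • (FreeAlgebra.ι k a * FreeAlgebra.ι k c))
  | d_mul_a : DoubleRel n q
      (FreeAlgebra.ι k d * FreeAlgebra.ι k a - q • (FreeAlgebra.ι k a * FreeAlgebra.ι k d))
      (1 - FreeAlgebra.ι k b * FreeAlgebra.ι k c)

end

/-- The Drinfeld double `D(Uₙ(q))` of the Taft algebra, by generators and relations. Only its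
algebra structure and the subalgebra generated by `a` and `b` enter below. -/
def TaftDouble {k : Type u} [Field k] (n : ℕ) (q : k) : Type u := RingQuot (DoubleRel n q)

namespace TaftDouble

variable {k : Type u} [Field k] (n : ℕ) (q : k)

instance : Ring (TaftDouble n q) := inferInstanceAs (Ring (RingQuot (DoubleRel n q)))

instance : Algebra k (TaftDouble n q) := inferInstanceAs (Algebra k (RingQuot (DoubleRel n q)))

/-- The quotient map from the free algebra. -/
def mkHom : FreeAlgebra k DoubleGen →ₐ[k] TaftDouble n q := RingQuot.mkAlgHom k (DoubleRel n q)

/-- The generator `a`. -/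
def a : TaftDouble n q := mkHom n q (FreeAlgebra.ι k DoubleGen.a)

/-- The generator `b`. -/
def b : TaftDouble n q := mkHom n q (FreeAlgebra.ι k DoubleGen.b)

/-- The generator `c`. -/
def c : TaftDouble n q := mkHom n q (FreeAlgebra.ι k DoubleGen.c)

/-- The generator `d`. -/
def d : TaftDouble n q := mkHom n q (FreeAlgebra.ι k DoubleGen.d)

theorem mkHom_rel {x y : FreeAlgebra k DoubleGen} (h : DoubleRel n q x y) :
    mkHom n q x = mkHom n q y := RingQuot.mkAlgHom_rel k h

theorem a_pow : a n q ^ n = 0 := by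
  simpa [a, b, c, d] using mkHom_rel n q DoubleRel.a_pow

theorem b_pow : b n q ^ n = 1 := by
  simpa [a, b, c, d] using mkHom_rel n q DoubleRel.b_pow

theorem c_pow : c n q ^ n = 1 := by
  simpa [a, b, c, d] using mkHom_rel n q DoubleRel.c_pow

theorem d_pow : d n q ^ n = 0 := by
  simpa [a, b, c, d] using mkHom_rel n q DoubleRel.d_pow

theorem b_mul_a : b n q * a n q = q • (a n q * b n q) := by
  simpa [a, b, c, d] using mkHom_rel n q DoubleRel.b_mul_a

theorem d_mul_c : d n q * c n q = q • (c n q * d n q) := by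
  simpa [a, b, c, d] using mkHom_rel n q DoubleRel.d_mul_c

theorem d_mul_b : d n q * b n q = q • (b n q * d n q) := by
  simpa [a, b, c, d] using mkHom_rel n q DoubleRel.d_mul_b

theorem b_mul_c : b n q * c n q = c n q * b n q := by
  simpa [a, b, c, d] using mkHom_rel n q DoubleRel.b_mul_c

theorem c_mul_a : c n q * a n q = q • (a n q * c n q) := by
  simpa [a, b, c, d] using mkHom_rel n q DoubleRel.c_mul_a

theorem d_mul_a : d n q * a n q - q • (a n q * d n q) = 1 - b n q * c n q := by
  simpa [a, b, c, d] using mkHom_rel n q DoubleRel.d_mul_a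

/-- The embedding of `R = Uₙ(q)` into its Drinfeld double, `a ↦ a`, `b ↦ b`. -/
def incl : Taft n q →ₐ[k] TaftDouble n q :=
  Taft.lift (a n q) (b n q) (a_pow n q) (b_pow n q) (b_mul_a n q)

variable [Fact (2 ≤ n)]

/-- The right ideal `R⁺ D(R)` of `D(R)`, where `R⁺ = ker ε` is the augmentation ideal of `R`. -/
def augIdeal : Submodule (TaftDouble n q)ᵐᵒᵖ (TaftDouble n q) :=
  Submodule.span (TaftDouble n q)ᵐᵒᵖ (incl n q '' {r | Taft.counitHom n q r = 0})

theorem mkQ_a_mul (z : TaftDouble n q) : (augIdeal n q).mkQ (a n q * z) = 0 := by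
  rw [Submodule.mkQ_apply, Submodule.Quotient.mk_eq_zero]
  refine Submodule.smul_mem _ (MulOpposite.op z) (Submodule.subset_span ⟨Taft.a n q, ?_, ?_⟩)
  · simp [Taft.counitHom]
  · simp [incl]

theorem mkQ_b_mul (z : TaftDouble n q) :
    (augIdeal n q).mkQ (b n q * z) = (augIdeal n q).mkQ z := by
  rw [← sub_eq_zero, ← map_sub, Submodule.mkQ_apply, Submodule.Quotient.mk_eq_zero]
  have h : b n q * z - z = MulOpposite.op z • (b n q - 1) := by
    rw [op_smul_eq_mul, sub_mul, one_mul]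
  rw [h]
  refine Submodule.smul_mem _ (MulOpposite.op z) (Submodule.subset_span ⟨Taft.b n q - 1, ?_, ?_⟩)
  · simp [Taft.counitHom]
  · simp [incl]

theorem span_quotient_eq_top :
    Submodule.span k (Set.range fun p : Fin n × Fin n =>
      (augIdeal n q).mkQ (c n q ^ (p.1 : ℕ) * d n q ^ (p.2 : ℕ))) = ⊤ := by
  have hpos : 0 < n := by have := Fact.out (p := 2 ≤ n); omega
  set S := Submodule.span k (Set.range fun p : Fin n × Fin n =>
      (augIdeal n q).mkQ (c n q ^ (p.1 : ℕ) * d n q ^ (p.2 : ℕ))) with hS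
  have hsmul : ∀ (r : k) (z : TaftDouble n q),
      (augIdeal n q).mkQ (r • z) = r • (augIdeal n q).mkQ z := fun _ _ => rfl
  have hmem : ∀ i j : ℕ, (augIdeal n q).mkQ (c n q ^ i * d n q ^ j) ∈ S := by
    intro i j
    rw [pow_eq_pow_mod i (c_pow n q)]
    rcases Nat.lt_or_ge j n with hj | hj
    · exact Submodule.subset_span ⟨(⟨i % n, Nat.mod_lt _ hpos⟩, ⟨j, hj⟩), rfl⟩
    · rw [pow_eq_zero_of_le hj (d_pow n q), mul_zero, map_zero]
      exact zero_mem _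
  have hcomm : ∀ (x y : TaftDouble n q), y * x = q • (x * y) →
      ∀ i : ℕ, y ^ i * x = q ^ i • (x * y ^ i) := by
    intro x y h i
    induction i with
    | zero => simp
    | succ i ih =>
      rw [pow_succ, mul_assoc, h, mul_smul_comm, ← mul_assoc, ih, smul_mul_assoc, smul_smul,
        mul_assoc, pow_succ, mul_comm q]
  have hcb : ∀ i : ℕ, c n q ^ i * b n q = b n q * c n q ^ i := fun i =>
    ((show Commute (c n q) (b n q) from (b_mul_c n q).symm).pow_left i).eq
  have hda : ∀ j : ℕ, ∃ α β : k, d n q ^ (j + 1) * a n q =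
      q ^ (j + 1) • (a n q * d n q ^ (j + 1)) + α • d n q ^ j +
        β • (b n q * c n q * d n q ^ j) := by
    have h0 : d n q * a n q = q • (a n q * d n q) + 1 - b n q * c n q := by
      rw [add_sub_assoc, ← d_mul_a]; abel
    have hdbc : d n q * (b n q * c n q) = (q * q) • (b n q * c n q * d n q) := by
      rw [← mul_assoc, d_mul_b, smul_mul_assoc, mul_assoc, d_mul_c, mul_smul_comm, smul_smul,
        mul_assoc]
    intro j
    induction j with
    | zero => exact ⟨1, -1, by simp [h0, sub_eq_add_neg]⟩
    | succ j ih =>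
      obtain ⟨α, β, h⟩ := ih
      refine ⟨α + q ^ (j + 1), q * q * β - q ^ (j + 1), ?_⟩
      rw [pow_succ' _ (j + 1), mul_assoc, h, mul_add, mul_add, mul_smul_comm, mul_smul_comm,
        mul_smul_comm, ← mul_assoc (d n q) (a n q), h0, ← mul_assoc (d n q) (b n q * c n q), hdbc,
        smul_mul_assoc, mul_assoc (b n q * c n q) (d n q), ← pow_succ', sub_mul, add_mul, one_mul,
        smul_mul_assoc, mul_assoc (a n q), ← pow_succ']
      simp only [smul_add, smul_sub, smul_smul, add_smul, sub_smul]
      rw [← pow_succ, mul_comm β]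
      abel
  have key : ∀ (y : FreeAlgebra k DoubleGen) (s : TaftDouble n q ⧸ augIdeal n q), s ∈ S →
      MulOpposite.op (mkHom n q y) • s ∈ S := by
    intro y
    induction y using FreeAlgebra.induction with
    | grade0 r =>
      intro s hs
      have e : MulOpposite.op (mkHom n q (algebraMap k _ r)) • s = r • s := by
        rw [AlgHom.commutes, ← MulOpposite.algebraMap_apply, algebraMap_smul]
      rw [e]
      exact S.smul_mem r hs
    | mul x y hx hy =>
      intro s hs
      rw [map_mul, MulOpposite.op_mul, mul_smul]
      exact hy _ (hx _ hs)
    | add x y hx hy =>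
      intro s hs
      rw [map_add, MulOpposite.op_add, add_smul]
      exact add_mem (hx _ hs) (hy _ hs)
    | grade1 t =>
      intro s hs
      induction hs using Submodule.span_induction with
      | zero => simp
      | add x y _ _ hx hy => rw [smul_add]; exact add_mem hx hy
      | smul r x _ hx => rw [smul_comm]; exact S.smul_mem r hx
      | mem x hx =>
        obtain ⟨⟨i, j⟩, rfl⟩ := hx
        change MulOpposite.op (mkHom n q (FreeAlgebra.ι k t)) •
          (augIdeal n q).mkQ (c n q ^ (i : ℕ) * d n q ^ (j : ℕ)) ∈ S
        generalize (i : ℕ) = i, (j : ℕ) = j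
        rw [← map_smul, op_smul_eq_mul, mul_assoc]
        cases t with
        | a =>
          change (augIdeal n q).mkQ (c n q ^ i * (d n q ^ j * a n q)) ∈ S
          cases j with
          | zero =>
            rw [pow_zero, one_mul, hcomm _ _ (c_mul_a n q), hsmul, mkQ_a_mul, smul_zero]
            exact zero_mem _
          | succ j =>
            obtain ⟨α, β, h⟩ := hda j
            rw [h, mul_add, mul_add, mul_smul_comm, mul_smul_comm, mul_smul_comm, ← mul_assoc,
              hcomm _ _ (c_mul_a n q), ← mul_assoc (c n q ^ i) (b n q * c n q),
              ← mul_assoc (c n q ^ i) (b n q), hcb, mul_assoc (b n q), ← pow_succ,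
              mul_assoc (b n q), smul_mul_assoc, mul_assoc (a n q), map_add, map_add, hsmul, hsmul,
              hsmul, hsmul, mkQ_a_mul, mkQ_b_mul, smul_zero, smul_zero, zero_add]
            exact add_mem (S.smul_mem _ (hmem _ _)) (S.smul_mem _ (hmem _ _))
        | b =>
          change (augIdeal n q).mkQ (c n q ^ i * (d n q ^ j * b n q)) ∈ S
          rw [hcomm _ _ (d_mul_b n q), mul_smul_comm, ← mul_assoc, hcb, mul_assoc, hsmul,
            mkQ_b_mul]
          exact S.smul_mem _ (hmem _ _)
        | c =>
          change (augIdeal n q).mkQ (c n q ^ i * (d n q ^ j * c n q)) ∈ S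
          rw [hcomm _ _ (d_mul_c n q), mul_smul_comm, ← mul_assoc, ← pow_succ, hsmul]
          exact S.smul_mem _ (hmem _ _)
        | d =>
          change (augIdeal n q).mkQ (c n q ^ i * (d n q ^ j * d n q)) ∈ S
          rw [← pow_succ]
          exact hmem _ _
  refine eq_top_iff.2 fun x _ => ?_
  obtain ⟨z, rfl⟩ := (augIdeal n q).mkQ_surjective x
  obtain ⟨y, rfl⟩ := RingQuot.mkAlgHom_surjective k (DoubleRel n q) z
  have h1 : (augIdeal n q).mkQ 1 ∈ S := by simpa using hmem 0 0
  have h2 := key y _ h1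
  rw [← map_smul, op_smul_eq_mul, one_mul] at h2
  exact h2

instance : FiniteDimensional k (TaftDouble n q ⧸ augIdeal n q) :=
  ⟨by rw [← span_quotient_eq_top n q]; exact Submodule.fg_span (Set.finite_range _)⟩

/-- The quotient module `Q = D(R) / R⁺ D(R)`, as a right module over `R = Uₙ(q)`. -/
def Q : RightMod k (Taft n q) :=
  (RightMod.ofModule k (TaftDouble n q) (TaftDouble n q ⧸ augIdeal n q)).restrict (incl n q)

end TaftDouble

/-- The Fibonacci-like polynomials: `u₁ = 1`, `u₂ = x`, `u_{ℓ+1} = x u_ℓ - a u_{ℓ-1}`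
(with `u₀ = 0`). -/
def fibPoly {A : Type*} [Ring A] (a x : A) : ℕ → A
  | 0 => 0
  | 1 => 1
  | l + 2 => x * fibPoly a x (l + 1) - a * fibPoly a x l

/-!
A weight vector of a right `Uₙ(q)`-module is an eigenvector of `b` for a power of `q`; acting by `a`
divides the weight by `q`. A string of length `ℓ` is a family `v, va, …, va^(ℓ-1)` with `v` a weight
vector and `va^ℓ = 0`. A module with a basis made of strings is determined by their lengths and top
weights (`Taft.iso_of_strings`).

The Jacobson radical of `Uₙ(q)` is generated by `a`, so `M(ℓ, i)` is a single string of length `ℓ`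
with top weight `qⁱ` (`Taft.exists_top_M`). Hence the class of a module with a basis of strings is the
sum of the corresponding `[M(ℓ, i)]` (`Taft.cls_eq_sum_of_strings`), and every identity needed in the
Green ring comes from exhibiting strings. In a tensor product they give
`[M(1, s)][M(ℓ, t)] = [M(ℓ, s + t)]` and
`[M(2, s)][M(ℓ, t)] = [M(ℓ + 1, s + t)] + [M(ℓ - 1, s + t - 1)]` for `1 ≤ ℓ < n`, whence
`u_ℓ = [M(ℓ, 0)]` (`Taft.fibPoly_eq_cls_M`).

The module `Q` is spanned by the classes of `cⁱ dʲ`, and left multiplication by `c` commutes with the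
action of `Uₙ(q)`. Projecting `1` to the eigenspace of `c` for `q⁻ᵗ` gives vectors `F_t dʲ` of weight
`qʲ` with `F_t dʲ⁺¹ · a = (1 + q + ⋯ + qʲ)(1 - qʲ⁻ᵗ) F_t dʲ`. They are linearly independent because
the double acts on functions on `ℤ/n` with a lowest weight vector of any `c`-weight
(`TaftDouble.linearIndependent_qVec`). For each `t` the coefficient vanishes only at `j = t`, so the
eigenspace is the sum of a string of length `t + 1` with top weight `qᵗ` and one of length `n - 1 - t`
with top weight `qⁿ⁻¹` (`TaftDouble.cls_Q`). Summing over `t` gives the formula.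
-/

/-! ### Direct sums and modules with a basis of strings -/

namespace RightMod

section

variable {k : Type u} {H : Type v} [Field k] [Ring H] [Algebra k H]

theorem act_pow_succ (V : RightMod k H) (h : H) (i : ℕ) (v : V.carrier) :
    V.act (h ^ (i + 1)) v = V.act h (V.act (h ^ i) v) := by
  rw [pow_succ, V.act_mul]

theorem act_algebraMap (V : RightMod k H) (r : k) (v : V.carrier) :
    V.act (algebraMap k H r) v = r • v := by
  rw [Algebra.algebraMap_eq_smul_one, map_smul, LinearMap.smul_apply, V.act_one]

/-- The direct sum of a finite family of right modules. -/
def pi {ι : Type} [Finite ι] (V : ι → RightMod k H) : RightMod k H where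
  carrier := ∀ i, (V i).carrier
  act :=
    { toFun := fun h => LinearMap.pi fun i => (V i).act h ∘ₗ LinearMap.proj i
      map_add' := fun g h => by ext; simp
      map_smul' := fun c h => by ext; simp }
  act_one v := by ext i; exact (V i).act_one _
  act_mul g h v := by ext i; exact (V i).act_mul _ _ _

end

end RightMod

namespace GreenRing

variable {k : Type u} {H : Type v} [Field k] [Ring H] [Bialgebra k H]

/-- The zero module satisfies `V ⊕ V ≅ V`. -/
theorem cls_eq_zero (V : RightMod k H) [Subsingleton V.carrier] : cls V = 0 := by
  have h : RightMod.Iso (V.prod V) V :=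
    ⟨{ LinearMap.fst k V.carrier V.carrier with
        invFun := fun v => (v, v)
        left_inv := fun x => Prod.ext (Subsingleton.elim _ _) (Subsingleton.elim _ _)
        right_inv := fun _ => rfl }, fun _ _ => rfl⟩
  simpa [cls_prod] using cls_eq_of_iso h

theorem cls_pi {ι : Type} [Fintype ι] (V : ι → RightMod k H) :
    cls (RightMod.pi V) = ∑ i, cls (V i) := by
  revert V
  refine Fintype.induction_empty_option
    (P := fun ι _ => ∀ V : ι → RightMod k H, cls (RightMod.pi V) = ∑ i, cls (V i)) ?_ ?_ ?_ ι
  · intro α β _ e ih V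
    let _ : Fintype α := Fintype.ofEquiv β e.symm
    rw [← e.sum_comp, ← ih fun i => V (e i)]
    exact cls_eq_of_iso ⟨(LinearEquiv.piCongrLeft k (fun i => (V i).carrier) e).symm,
      fun h v => rfl⟩
  · intro V
    have : Subsingleton (RightMod.pi V).carrier :=
      inferInstanceAs (Subsingleton (∀ i : PEmpty, (V i).carrier))
    simp [cls_eq_zero]
  · intro α _ ih V
    rw [Fintype.sum_option, ← ih fun i => V (some i), ← cls_prod]
    exact cls_eq_of_iso ⟨LinearEquiv.piOptionEquivProd k, fun h v => rfl⟩

end GreenRing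

namespace Taft

variable {k : Type u} [Field k] {n : ℕ} {q : k}

/-- A linear map of right `Uₙ(q)`-modules need only be tested on the two generators. -/
theorem map_act_of_generators {V W : RightMod k (Taft n q)} (e : V.carrier →ₗ[k] W.carrier)
    (ha : ∀ v, e (V.act (a n q) v) = W.act (a n q) (e v))
    (hb : ∀ v, e (V.act (b n q) v) = W.act (b n q) (e v)) (h : Taft n q) (v : V.carrier) :
    e (V.act h v) = W.act h (e v) := by
  obtain ⟨y, rfl⟩ := RingQuot.mkAlgHom_surjective k (TaftRel n q) h
  change e (V.act (mkHom n q y) v) = W.act (mkHom n q y) (e v)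
  induction y using FreeAlgebra.induction generalizing v with
  | grade0 r => rw [AlgHom.commutes, RightMod.act_algebraMap, RightMod.act_algebraMap, map_smul]
  | grade1 t =>
    cases t
    · exact ha v
    · exact hb v
  | mul x y hx hy => rw [map_mul, V.act_mul, W.act_mul, hy, hx]
  | add x y hx hy =>
    rw [map_add, map_add, map_add, LinearMap.add_apply, LinearMap.add_apply, map_add, hx, hy]

theorem b_mul_a_pow (m : ℕ) : b n q * a n q ^ m = q ^ m • (a n q ^ m * b n q) := by
  induction m with
  | zero => simp
  | succ m ih =>
    rw [pow_succ, ← mul_assoc, ih, smul_mul_assoc, mul_assoc, b_mul_a, mul_smul_comm, smul_smul,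
      mul_assoc, pow_succ]

/-- Acting by `a` lowers the weight, i.e. divides the eigenvalue of `b` by `q`. -/
theorem act_b_act_a_pow (hq : q ≠ 0) (V : RightMod k (Taft n q)) {v : V.carrier} {t : ℤ}
    (hv : V.act (b n q) v = q ^ t • v) (i : ℕ) :
    V.act (b n q) (V.act (a n q ^ i) v) = q ^ (t - i) • V.act (a n q ^ i) v := by
  have h : q ^ i • V.act (b n q) (V.act (a n q ^ i) v) = q ^ t • V.act (a n q ^ i) v := by
    rw [← V.act_mul, ← LinearMap.smul_apply, ← map_smul, ← b_mul_a_pow, V.act_mul, hv, map_smul]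
  rw [zpow_sub₀ hq, div_eq_inv_mul, mul_smul, ← h, zpow_natCast, inv_smul_smul₀ (pow_ne_zero _ hq)]

/-- The vectors `v_j aⁱ`, `i < ℓ_j`, of the strings below a family of vectors `v_j`. The length
`ℓ_j` is prescribed; in the applications `v_j` is a weight vector killed by `a ^ ℓ_j`. -/
def strings (V : RightMod k (Taft n q)) {ι : Type} (l : ι → ℕ) (v : ι → V.carrier) :
    (Σ j, Fin (l j)) → V.carrier :=
  fun p => V.act (a n q ^ (p.2 : ℕ)) (v p.1)

/-- Two modules with bases consisting of strings of the same lengths and the same top weights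
are isomorphic. -/
theorem iso_of_strings (hq : q ≠ 0) {V W : RightMod k (Taft n q)} {ι : Type} {l : ι → ℕ}
    {t : ι → ℤ} (v : ι → V.carrier) (w : ι → W.carrier)
    (hvb : ∀ j, V.act (b n q) (v j) = q ^ t j • v j)
    (hwb : ∀ j, W.act (b n q) (w j) = q ^ t j • w j)
    (hva : ∀ j, V.act (a n q ^ l j) (v j) = 0) (hwa : ∀ j, W.act (a n q ^ l j) (w j) = 0)
    (hv : LinearIndependent k (strings V l v))
    (hv' : ⊤ ≤ Submodule.span k (Set.range (strings V l v)))
    (hw : LinearIndependent k (strings W l w))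
    (hw' : ⊤ ≤ Submodule.span k (Set.range (strings W l w))) : RightMod.Iso V W := by
  let B := Module.Basis.mk hv hv'
  let C := Module.Basis.mk hw hw'
  let e := B.equiv C (Equiv.refl _)
  have he : ∀ j i, i ≤ l j → e (V.act (a n q ^ i) (v j)) = W.act (a n q ^ i) (w j) := by
    intro j i hi
    rcases hi.lt_or_eq with hi | rfl
    · have := B.equiv_apply ⟨j, i, hi⟩ C (Equiv.refl _)
      simpa [B, C, strings] using this
    · rw [hva, hwa, map_zero]
  refine ⟨e, fun h x => map_act_of_generators e.toLinearMap ?_ ?_ h x⟩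
  · intro x
    have : e.toLinearMap ∘ₗ V.act (a n q) = W.act (a n q) ∘ₗ e.toLinearMap := by
      refine B.ext fun p => ?_
      obtain ⟨j, i, hi⟩ := p
      simp only [B, Module.Basis.mk_apply, strings, LinearMap.comp_apply, LinearEquiv.coe_coe]
      rw [← RightMod.act_pow_succ, he j _ hi, he j _ hi.le, RightMod.act_pow_succ]
    exact LinearMap.congr_fun this x
  · intro x
    have : e.toLinearMap ∘ₗ V.act (b n q) = W.act (b n q) ∘ₗ e.toLinearMap := by
      refine B.ext fun p => ?_
      obtain ⟨j, i, hi⟩ := p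
      simp only [B, Module.Basis.mk_apply, strings, LinearMap.comp_apply, LinearEquiv.coe_coe]
      rw [act_b_act_a_pow hq V (hvb j), map_smul, he j _ hi.le, act_b_act_a_pow hq W (hwb j)]
    exact LinearMap.congr_fun this x

end Taft

/-! ### Representations of the Drinfeld double on functions on `ℤ/n` -/

section Weights

variable {k : Type u} [Field k] {n : ℕ}

theorem neZero_of_two_le (n : ℕ) [hn : Fact (2 ≤ n)] : NeZero n := ⟨by have := hn.out; omega⟩

attribute [local instance] neZero_of_two_le

theorem root_ne_zero (n : ℕ) (q : k) [hn : Fact (2 ≤ n)] [hq : Fact (IsPrimitiveRoot q n)] :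
    q ≠ 0 := hq.out.ne_zero (NeZero.ne n)

theorem root_ne_one (n : ℕ) (q : k) [hn : Fact (2 ≤ n)] [hq : Fact (IsPrimitiveRoot q n)] :
    q ≠ 1 := hq.out.ne_one hn.out

theorem val_add_one_of_lt {j : ZMod n} (h : j.val + 1 < n) : (j + 1).val = j.val + 1 := by
  have : NeZero n := ⟨by omega⟩
  have h1 := ZMod.val_cast_of_lt h
  rwa [Nat.cast_add, ZMod.natCast_zmod_val, Nat.cast_one] at h1

/-- The exponent of `q` only matters modulo `n`. -/
theorem pow_val_natCast (q : k) [hq : Fact (IsPrimitiveRoot q n)] (m : ℕ) :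
    q ^ (m : ZMod n).val = q ^ m := by
  rw [ZMod.val_natCast, ← pow_eq_pow_mod m hq.out.pow_eq_one]

theorem pow_val_add_one (q : k) [hn : Fact (2 ≤ n)] [hq : Fact (IsPrimitiveRoot q n)] (j : ZMod n) :
    q ^ (j + 1).val = q * q ^ j.val := by
  have h := pow_val_natCast (n := n) q (j.val + 1)
  rwa [Nat.cast_add, ZMod.natCast_zmod_val, Nat.cast_one, pow_succ'] at h

end Weights

namespace TaftDouble

attribute [local instance] neZero_of_two_le

variable {k : Type u} [Field k] (n : ℕ) (q : k)

/-- The action of `a` on functions `f` on `ℤ/n`, where the function concentrated in `j` has weight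
`qʲ`: it lowers `j` by one. The factor `q ^ (j + 1) - 1` vanishes at `j = -1`, so nothing wraps
around from `0` to `n - 1`; the factor `1 - qʲ s` may split the string further. -/
def opA (s : k) : Module.End k (ZMod n → k) where
  toFun f j := (q ^ (j + 1).val - 1) / (q - 1) * (1 - q ^ j.val * s) * f (j + 1)
  map_add' f g := by ext j; simp [mul_add]
  map_smul' c f := by ext j; simp; ring

/-- The action of `b`: multiplication by `qʲ` in degree `j`. -/
def opB : Module.End k (ZMod n → k) where
  toFun f j := q ^ j.val * f j
  map_add' f g := by ext j; simp [mul_add]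
  map_smul' c f := by ext j; simp; ring

/-- The action of `d`: the shift that raises the degree by one, cut off at `n - 1`. -/
def opD : Module.End k (ZMod n → k) where
  toFun f j := if j = 0 then 0 else f (j - 1)
  map_add' f g := by ext j; by_cases h : j = 0 <;> simp [h]
  map_smul' c f := by ext j; simp

theorem opA_apply (s : k) (f : ZMod n → k) (j : ZMod n) : opA n q s f j =
    (q ^ (j + 1).val - 1) / (q - 1) * (1 - q ^ j.val * s) * f (j + 1) := rfl

theorem opB_apply (f : ZMod n → k) (j : ZMod n) : opB n q f j = q ^ j.val * f j := rfl

theorem opD_apply (f : ZMod n → k) (j : ZMod n) :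
    opD (k := k) n f j = if j = 0 then 0 else f (j - 1) := rfl

theorem opB_pow_apply (m : ℕ) (f : ZMod n → k) (j : ZMod n) :
    (opB n q ^ m) f j = (q ^ j.val) ^ m * f j := by
  induction m with
  | zero => simp
  | succ m ih => rw [pow_succ', Module.End.mul_apply, opB_apply, ih]; ring

theorem opA_opD (s : k) (f : ZMod n → k) (j : ZMod n) : opA n q s (opD n f) j =
    (q ^ (j + 1).val - 1) / (q - 1) * (1 - q ^ j.val * s) * f j := by
  rw [opA_apply, opD_apply]
  split_ifs with h
  · simp [h]
  · rw [add_sub_cancel_right]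

theorem opD_opA (s : k) (f : ZMod n → k) (j : ZMod n) : opD n (opA n q s f) j =
    (q ^ j.val - 1) / (q - 1) * (1 - q ^ (j - 1).val * s) * f j := by
  rw [opD_apply]
  split_ifs with h
  · simp [h]
  · rw [opA_apply, sub_add_cancel]

variable [hn : Fact (2 ≤ n)] [hq : Fact (IsPrimitiveRoot q n)]

theorem opA_pow_apply_eq_zero (s : k) (m : ℕ) (f : ZMod n → k) (j : ZMod n)
    (h : n ≤ j.val + m) : (opA n q s ^ m) f j = 0 := by
  induction m generalizing j with
  | zero => exact absurd j.val_lt (by omega)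
  | succ m ih =>
    rw [pow_succ', Module.End.mul_apply, opA_apply]
    rcases (Nat.succ_le_of_lt j.val_lt).lt_or_eq with h1 | h1
    · rw [ih, mul_zero]
      rw [val_add_one_of_lt h1]
      omega
    · have : q ^ (j + 1).val = 1 := by
        rw [pow_val_add_one, ← pow_succ', ← Nat.succ_eq_add_one, h1, hq.out.pow_eq_one]
      simp [this]

theorem opD_pow_apply_eq_zero (m : ℕ) (f : ZMod n → k) (j : ZMod n)
    (h : j.val < m) : (opD (k := k) n ^ m) f j = 0 := by
  induction m generalizing j with
  | zero => omega
  | succ m ih =>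
    rw [pow_succ', Module.End.mul_apply, opD_apply]
    split_ifs with h0
    · rfl
    · refine ih _ ?_
      have : Fact (1 < n) := ⟨hn.out⟩
      have h1 : j.val ≠ 0 := by rwa [Ne, ZMod.val_eq_zero]
      rw [ZMod.val_sub (by rw [ZMod.val_one]; omega), ZMod.val_one]
      omega

/-- The `n`-dimensional right representation of the double with lowest weight vector of
`b`-weight `1` and `c`-weight `s`. A right action is an algebra map to the opposite of the
endomorphism ring. -/
def stringRep (s : k) (hs : s ^ n = 1) : TaftDouble n q →ₐ[k] (Module.End k (ZMod n → k))ᵐᵒᵖ :=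
  RingQuot.liftAlgHom k ⟨FreeAlgebra.lift k fun g => match g with
    | DoubleGen.a => MulOpposite.op (opA n q s)
    | DoubleGen.b => MulOpposite.op (opB n q)
    | DoubleGen.c => MulOpposite.op (s • opB n q)
    | DoubleGen.d => MulOpposite.op (opD n), by
      have hs1 : ∀ j : ZMod n, q ^ (j - 1).val * q = q ^ j.val := fun j => by
        have := pow_val_add_one q (j - 1)
        rw [sub_add_cancel] at this
        rw [this, mul_comm]
      have hq1 : q - 1 ≠ 0 := sub_ne_zero.2 (root_ne_one n q)
      have hBn : opB n q ^ n = 1 := by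
        refine LinearMap.ext fun f => funext fun j => ?_
        rw [opB_pow_apply, ← pow_mul, pow_mul', hq.out.pow_eq_one, one_pow, one_mul,
          Module.End.one_apply]
      rintro _ _ (_ | _ | _ | _ | _ | _ | _ | _ | _ | _) <;>
        simp only [map_pow, map_mul, map_sub, map_one, map_zero, map_smul, FreeAlgebra.lift_ι_apply,
          ← MulOpposite.op_pow, ← MulOpposite.op_mul, ← MulOpposite.op_smul,
          ← MulOpposite.op_sub, ← MulOpposite.op_one, ← MulOpposite.op_zero] <;>
        refine congrArg MulOpposite.op ?_
      · refine LinearMap.ext fun f => funext fun j => ?_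
        exact opA_pow_apply_eq_zero n q s n _ j (by omega)
      · exact hBn
      · rw [smul_pow, hs, one_smul, hBn]
      · refine LinearMap.ext fun f => funext fun j => ?_
        exact opD_pow_apply_eq_zero n n _ j j.val_lt
      · refine LinearMap.ext fun f => funext fun j => ?_
        simp [opA_apply, opB_apply, pow_val_add_one]
        ring
      · refine LinearMap.ext fun f => funext fun j => ?_
        simp only [Module.End.mul_apply, LinearMap.smul_apply, Pi.smul_apply, smul_eq_mul,
          opD_apply, opB_apply]
        split_ifs
        · simp
        · rw [← hs1 j]
          ring
      · refine LinearMap.ext fun f => funext fun j => ?_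
        simp only [Module.End.mul_apply, LinearMap.smul_apply, Pi.smul_apply, smul_eq_mul,
          opD_apply, opB_apply]
        split_ifs
        · simp
        · rw [← hs1 j]
          ring
      · rw [smul_mul_assoc, mul_smul_comm]
      · refine LinearMap.ext fun f => funext fun j => ?_
        simp [opA_apply, opB_apply, pow_val_add_one]
        ring
      · refine LinearMap.ext fun f => funext fun j => ?_
        simp only [LinearMap.sub_apply, Module.End.mul_apply, Module.End.one_apply,
          LinearMap.smul_apply, Pi.smul_apply, Pi.sub_apply, smul_eq_mul, opA_opD, opD_opA,
          opB_apply, pow_val_add_one]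
        have h := hs1 j
        field_simp
        linear_combination (q ^ j.val - 1) * s * f j * h⟩

theorem stringRep_a (s : k) (hs : s ^ n = 1) :
    stringRep n q s hs (a n q) = MulOpposite.op (opA n q s) :=
  (RingQuot.liftAlgHom_mkAlgHom_apply k _ _ _).trans (FreeAlgebra.lift_ι_apply _ _)

theorem stringRep_b (s : k) (hs : s ^ n = 1) :
    stringRep n q s hs (b n q) = MulOpposite.op (opB n q) :=
  (RingQuot.liftAlgHom_mkAlgHom_apply k _ _ _).trans (FreeAlgebra.lift_ι_apply _ _)

theorem stringRep_c (s : k) (hs : s ^ n = 1) :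
    stringRep n q s hs (c n q) = MulOpposite.op (s • opB n q) :=
  (RingQuot.liftAlgHom_mkAlgHom_apply k _ _ _).trans (FreeAlgebra.lift_ι_apply _ _)

theorem stringRep_d (s : k) (hs : s ^ n = 1) :
    stringRep n q s hs (d n q) = MulOpposite.op (opD n) :=
  (RingQuot.liftAlgHom_mkAlgHom_apply k _ _ _).trans (FreeAlgebra.lift_ι_apply _ _)

/-- The right module over the double that `stringRep` defines. -/
def stringMod (s : k) (hs : s ^ n = 1) : RightMod k (TaftDouble n q) where
  carrier := ZMod n → k
  act := (MulOpposite.opLinearEquiv k).symm.toLinearMap ∘ₗ (stringRep n q s hs).toLinearMap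
  act_one v := by simp
  act_mul g h v := by simp

theorem stringMod_a (s : k) (hs : s ^ n = 1) (f : ZMod n → k) :
    (stringMod n q s hs).act (a n q) f = opA n q s f :=
  congrArg (fun g : (Module.End k (ZMod n → k))ᵐᵒᵖ => g.unop f) (stringRep_a n q s hs)

theorem stringMod_b (s : k) (hs : s ^ n = 1) (f : ZMod n → k) :
    (stringMod n q s hs).act (b n q) f = opB n q f :=
  congrArg (fun g : (Module.End k (ZMod n → k))ᵐᵒᵖ => g.unop f) (stringRep_b n q s hs)

theorem stringMod_c (s : k) (hs : s ^ n = 1) (f : ZMod n → k) :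
    (stringMod n q s hs).act (c n q) f = s • opB n q f :=
  congrArg (fun g : (Module.End k (ZMod n → k))ᵐᵒᵖ => g.unop f) (stringRep_c n q s hs)

theorem stringMod_d (s : k) (hs : s ^ n = 1) (f : ZMod n → k) :
    (stringMod n q s hs).act (d n q) f = opD n f :=
  congrArg (fun g : (Module.End k (ZMod n → k))ᵐᵒᵖ => g.unop f) (stringRep_d n q s hs)

end TaftDouble

/-! ### Idempotents and the Jacobson radical -/

section RootIdem

attribute [local instance] neZero_of_two_le

variable {k : Type u} [Field k] {A : Type v} [Ring A] [Algebra k A]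

/-- The average `(1/n) ∑ⱼ tʲ yʲ`, `j < n`. When `tⁿ = 1 = yⁿ` and `n` is invertible, it projects
onto the eigenspace of `y` for the eigenvalue `t⁻¹`. -/
def rootIdem (n : ℕ) (t : k) (y : A) : A :=
  (n : k)⁻¹ • ∑ j ∈ Finset.range n, t ^ j • y ^ j

theorem rootIdem_commute (n : ℕ) (t : k) {y z : A} (h : Commute y z) :
    Commute (rootIdem n t y) z :=
  (Commute.sum_left _ _ _ fun j _ => (h.pow_left j).smul_left _).smul_left _

theorem smul_mul_rootIdem {n : ℕ} {t : k} {y : A} (ht : t ^ n = 1) (hy : y ^ n = 1) :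
    t • (y * rootIdem n t y) = rootIdem n t y := by
  rw [rootIdem, mul_smul_comm, smul_comm t, Finset.mul_sum, Finset.smul_sum]
  congr 1
  have h := Finset.sum_range_succ (fun j => t ^ j • y ^ j) n
  rw [Finset.sum_range_succ'] at h
  simp only [pow_zero, ht, hy] at h
  rw [← add_right_cancel h]
  refine Finset.sum_congr rfl fun j _ => ?_
  rw [mul_smul_comm, smul_smul, ← pow_succ', ← pow_succ']

theorem rootIdem_mul_of_mul_eq_smul {n : ℕ} {q t : k} {x y : A} (h : y * x = q • (x * y)) :
    rootIdem n t y * x = x * rootIdem n (t * q) y := by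
  have hx : ∀ j : ℕ, y ^ j * x = q ^ j • (x * y ^ j) := by
    intro j
    induction j with
    | zero => simp
    | succ j ih =>
      rw [pow_succ, mul_assoc, h, mul_smul_comm, ← mul_assoc, ih, smul_mul_assoc, smul_smul,
        mul_assoc, pow_succ, mul_comm q]
  simp only [rootIdem, smul_mul_assoc, mul_smul_comm, Finset.sum_mul, Finset.mul_sum, hx,
    smul_smul, mul_pow]

variable {n : ℕ}

theorem act_rootIdem (V : RightMod k A) {t s : k} {y : A} {v : V.carrier}
    (hv : V.act y v = s • v) :
    V.act (rootIdem n t y) v = ((n : k)⁻¹ * ∑ j ∈ Finset.range n, (t * s) ^ j) • v := by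
  have hp : ∀ j : ℕ, V.act (y ^ j) v = s ^ j • v := by
    intro j
    induction j with
    | zero => simp [V.act_one]
    | succ j ih => rw [RightMod.act_pow_succ, ih, map_smul, hv, smul_smul, pow_succ]
  rw [rootIdem, map_smul, map_sum, LinearMap.smul_apply, LinearMap.sum_apply]
  simp only [map_smul, LinearMap.smul_apply, hp, smul_smul, ← mul_pow]
  rw [← Finset.sum_smul, smul_smul]

theorem act_rootIdem_eq_zero (V : RightMod k A) {t s : k} {y : A} {v : V.carrier}
    (hv : V.act y v = s • v) (h : t * s ≠ 1) (hts : (t * s) ^ n = 1) :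
    V.act (rootIdem n t y) v = 0 := by
  have h2 := geom_sum_mul (t * s) n
  rw [hts, sub_self] at h2
  rw [act_rootIdem V hv, (mul_eq_zero.1 h2).resolve_right (sub_ne_zero.2 h), mul_zero, zero_smul]

variable [hn : Fact (2 ≤ n)]

theorem act_rootIdem_eq_self (V : RightMod k A) (q : k) [hq : Fact (IsPrimitiveRoot q n)]
    {t s : k} {y : A} {v : V.carrier} (hv : V.act y v = s • v) (h : t * s = 1) :
    V.act (rootIdem n t y) v = v := by
  have hn0 : (n : k) ≠ 0 := (hq.out.neZero').out
  rw [act_rootIdem V hv, h]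
  simp [hn0]

theorem sum_range_rootIdem (q : k) [hq : Fact (IsPrimitiveRoot q n)] (y : A) :
    ∑ i ∈ Finset.range n, rootIdem n (q ^ i) y = 1 := by
  have hn0 : (n : k) ≠ 0 := (hq.out.neZero').out
  simp only [rootIdem]
  rw [← Finset.smul_sum, Finset.sum_comm, Finset.sum_eq_single 0]
  · simp [← Nat.cast_smul_eq_nsmul k n (1 : A), smul_smul, hn0]
  · intro j hj hj0
    rw [← Finset.sum_smul]
    have h1 : q ^ j - 1 ≠ 0 := sub_ne_zero.2
      (hq.out.pow_ne_one_of_pos_of_lt hj0 (Finset.mem_range.1 hj))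
    have h2 := geom_sum_mul (q ^ j) n
    rw [pow_right_comm, hq.out.pow_eq_one, one_pow, sub_self] at h2
    simp only [pow_right_comm q _ j]
    rw [(mul_eq_zero.1 h2).resolve_right h1, zero_smul]
  · intro h
    exact absurd (Finset.mem_range.2 (NeZero.pos n)) h

end RootIdem

namespace Taft

attribute [local instance] neZero_of_two_le

variable {k : Type u} [Field k] {n : ℕ} {q : k}

/-- Since `ba = qab`, the right ideal `a Uₙ(q)` is two-sided. -/
theorem exists_mul_a_eq (r : Taft n q) : ∃ h, r * a n q = a n q * h := by
  obtain ⟨y, rfl⟩ := RingQuot.mkAlgHom_surjective k (TaftRel n q) r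
  change ∃ h, mkHom n q y * a n q = a n q * h
  induction y using FreeAlgebra.induction with
  | grade0 r => exact ⟨mkHom n q (algebraMap k _ r), by rw [AlgHom.commutes, Algebra.commutes]⟩
  | grade1 t =>
    cases t
    · exact ⟨a n q, rfl⟩
    · exact ⟨q • b n q, by rw [mul_smul_comm]; exact b_mul_a n q⟩
  | mul x y hx hy =>
    obtain ⟨x', hx⟩ := hx
    obtain ⟨y', hy⟩ := hy
    exact ⟨x' * y', by rw [map_mul, mul_assoc, hy, ← mul_assoc, hx, mul_assoc]⟩
  | add x y hx hy =>
    obtain ⟨x', hx⟩ := hx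
    obtain ⟨y', hy⟩ := hy
    exact ⟨x' + y', by rw [map_add, add_mul, hx, hy, mul_add]⟩

/-- As `ba = qab`, all multiples of `a` are nilpotent. -/
theorem op_a_mem_jacobson : MulOpposite.op (a n q) ∈ Ring.jacobson (Taft n q)ᵐᵒᵖ := by
  rw [← Ideal.jacobson_bot, Ideal.mem_jacobson_iff]
  intro y
  have h1 : ∀ m : ℕ, ∃ h, (a n q * y.unop) ^ m = a n q ^ m * h := by
    intro m
    induction m with
    | zero => exact ⟨1, by simp⟩
    | succ m ih =>
      obtain ⟨h, hh⟩ := ih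
      obtain ⟨h', hh'⟩ := exists_mul_a_eq h
      exact ⟨h' * y.unop, by
        rw [pow_succ, hh, mul_assoc, ← mul_assoc h, hh', pow_succ]
        simp only [mul_assoc]⟩
  have h2 : IsNilpotent (y * MulOpposite.op (a n q)) := by
    obtain ⟨h, hh⟩ := h1 n
    refine ⟨n, MulOpposite.unop_injective ?_⟩
    rw [MulOpposite.unop_pow, MulOpposite.unop_mul, MulOpposite.unop_op, hh, a_pow, zero_mul,
      MulOpposite.unop_zero]
  obtain ⟨u, hu⟩ := h2.isUnit_add_one
  refine ⟨((u⁻¹ : _ˣ) : (Taft n q)ᵐᵒᵖ), ?_⟩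
  rw [Submodule.mem_bot, mul_assoc, ← mul_add_one, ← hu, Units.inv_mul, sub_self]

/-- Modulo `a` the Taft algebra is a product of copies of `k`, so its Jacobson radical is contained
in `a Uₙ(q)`: each idempotent `(1/n) ∑ⱼ tʲ bʲ` multiplies `r` into `χ(r)` times itself plus a
multiple of `a`, where the character `χ` sends `b` to `t⁻¹` and vanishes on the radical. -/
theorem exists_eq_a_mul_of_mem_jacobson [hn : Fact (2 ≤ n)] [hq : Fact (IsPrimitiveRoot q n)]
    {x : (Taft n q)ᵐᵒᵖ} (hx : x ∈ Ring.jacobson (Taft n q)ᵐᵒᵖ) : ∃ h, x.unop = a n q * h := by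
  have key : ∀ (t : k) (ht : t ^ n = 1), ∃ h, rootIdem n t (b n q) * x.unop = a n q * h := by
    intro t ht
    have ht0 : t ≠ 0 := fun h => by simp [h, NeZero.ne n] at ht
    let χ : Taft n q →ₐ[k] k := lift 0 t⁻¹ (zero_pow (NeZero.ne n)) (by rw [inv_pow, ht, inv_one])
      (by simp)
    have h1 : ∀ r, ∃ h, rootIdem n t (b n q) * r = χ r • rootIdem n t (b n q) + a n q * h := by
      intro r
      obtain ⟨y, rfl⟩ := RingQuot.mkAlgHom_surjective k (TaftRel n q) r
      change ∃ h, _ * mkHom n q y = χ (mkHom n q y) • _ + a n q * h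
      induction y using FreeAlgebra.induction with
      | grade0 r =>
        exact ⟨0, by rw [AlgHom.commutes, AlgHom.commutes, ← Algebra.commutes, ← Algebra.smul_def,
          mul_zero, add_zero]; rfl⟩
      | grade1 g =>
        cases g
        · refine ⟨rootIdem n (t * q) (b n q), ?_⟩
          change rootIdem n t (b n q) * a n q = χ (a n q) • _ + _
          rw [rootIdem_mul_of_mul_eq_smul (b_mul_a n q), lift_a, zero_smul, zero_add]
        · refine ⟨0, ?_⟩
          change rootIdem n t (b n q) * b n q = χ (b n q) • _ + _
          rw [mul_zero, add_zero, lift_b, eq_inv_smul_iff₀ ht0,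
            (rootIdem_commute n t (Commute.refl (b n q))).eq, smul_mul_rootIdem ht (b_pow n q)]
      | mul x y hx hy =>
        obtain ⟨x', hx⟩ := hx
        obtain ⟨y', hy⟩ := hy
        refine ⟨χ (mkHom n q x) • y' + x' * mkHom n q y, ?_⟩
        rw [map_mul, map_mul, ← mul_assoc, hx, add_mul, smul_mul_assoc, hy, smul_add, smul_smul,
          mul_add, mul_smul_comm, mul_assoc, add_assoc]
      | add x y hx hy =>
        obtain ⟨x', hx⟩ := hx
        obtain ⟨y', hy⟩ := hy
        refine ⟨x' + y', ?_⟩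
        rw [map_add, map_add, mul_add, hx, hy, mul_add, add_smul]
        abel
    have h2 : χ x.unop = 0 := by
      let f : (Taft n q)ᵐᵒᵖ →+* k := (χ : Taft n q →+* k).fromOpposite fun _ _ => Commute.all _ _
      have hf : Function.Surjective f := fun r =>
        ⟨MulOpposite.op (algebraMap k _ r), χ.commutes r⟩
      have := RingHom.ker_isMaximal_of_surjective f hf
      exact Ring.jacobson_le_of_isMaximal (RingHom.ker f) hx
    obtain ⟨h, hh⟩ := h1 x.unop
    exact ⟨h, by rw [hh, h2, zero_smul, zero_add]⟩
  choose! g hg using key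
  refine ⟨∑ i ∈ Finset.range n, g (q ^ i), ?_⟩
  rw [Finset.mul_sum, ← one_mul x.unop, ← sum_range_rootIdem (n := n) q (b n q), Finset.sum_mul]
  refine Finset.sum_congr rfl fun i _ => ?_
  rw [hg _ (by rw [pow_right_comm, hq.out.pow_eq_one, one_pow])]

theorem idem_eq_rootIdem (i : ℤ) : idem n q i = rootIdem n (q ^ (i - 1)) (b n q) := by
  simp only [idem, rootIdem, zpow_mul, zpow_natCast]

theorem zpow_pow_root (q : k) [hq : Fact (IsPrimitiveRoot q n)] (i : ℤ) : (q ^ i) ^ n = 1 := by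
  rw [← zpow_natCast, zpow_comm, zpow_natCast, hq.out.pow_eq_one, one_zpow]

variable [hn : Fact (2 ≤ n)] [hq : Fact (IsPrimitiveRoot q n)]

theorem idem_mul_b (i : ℤ) : idem n q i * b n q = q ^ (1 - i) • idem n q i := by
  have h0 := root_ne_zero n q
  have h := smul_mul_rootIdem (t := q ^ (i - 1)) (zpow_pow_root (n := n) q _) (b_pow n q)
  rw [← idem_eq_rootIdem, idem_eq_rootIdem,
    ← (rootIdem_commute n _ (Commute.refl (b n q))).eq, ← idem_eq_rootIdem] at h
  rw [← neg_sub i 1, zpow_neg, eq_inv_smul_iff₀ (zpow_ne_zero _ h0), h]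

/-- As `J = a Uₙ(q)`, the module `Pᵢ Jʳ` is generated by `eᵢ aʳ`. -/
theorem PJ_eq_span (i : ℤ) (r : ℕ) :
    PJ n q i r = Submodule.span (Taft n q)ᵐᵒᵖ {idem n q i * a n q ^ r} := by
  have step : ∀ m : ℕ, Ring.jacobson (Taft n q)ᵐᵒᵖ •
      Submodule.span (Taft n q)ᵐᵒᵖ {idem n q i * a n q ^ m} =
        Submodule.span (Taft n q)ᵐᵒᵖ {idem n q i * a n q ^ (m + 1)} := by
    intro m
    apply le_antisymm
    · refine Submodule.smul_le.2 fun j hj x hx => ?_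
      obtain ⟨h, rfl⟩ := Submodule.mem_span_singleton.1 hx
      obtain ⟨h', hh'⟩ := exists_eq_a_mul_of_mem_jacobson (Ideal.mul_mem_right h _ hj)
      refine Submodule.mem_span_singleton.2 ⟨MulOpposite.op h', ?_⟩
      rw [smul_smul, MulOpposite.smul_eq_mul_unop, MulOpposite.smul_eq_mul_unop, hh',
        MulOpposite.unop_op, pow_succ]
      simp only [mul_assoc]
    · rw [Submodule.span_singleton_le_iff_mem, pow_succ, ← mul_assoc]
      exact Submodule.smul_mem_smul op_a_mem_jacobson (Submodule.mem_span_singleton_self _)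
  have main : ∀ r m : ℕ, Ring.jacobson (Taft n q)ᵐᵒᵖ ^ r •
      Submodule.span (Taft n q)ᵐᵒᵖ {idem n q i * a n q ^ m} =
        Submodule.span (Taft n q)ᵐᵒᵖ {idem n q i * a n q ^ (m + r)} := by
    intro r
    induction r with
    | zero => intro m; rw [Submodule.pow_zero, Ideal.one_eq_top, Submodule.top_smul, add_zero]
    | succ r ih =>
      intro m
      rw [Submodule.pow_succ, Submodule.mul_smul, step, ih, add_right_comm, add_assoc]
  have := main r 0
  rwa [pow_zero, mul_one, zero_add] at this

/-- The module `stringMod` for `s = q`, restricted along `a ↦ a`, `b ↦ qᵗ b`, detects that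
`eᵢ aⁿ⁻¹` does not vanish. -/
theorem idem_mul_a_pow_ne_zero (i : ℤ) : idem n q i * a n q ^ (n - 1) ≠ 0 := by
  have hn2 := hn.out
  let f : Taft n q →ₐ[k] Taft n q := lift (a n q) (q ^ (2 - i) • b n q) (a_pow n q)
    (by rw [smul_pow, zpow_pow_root, b_pow, one_smul])
    (by rw [smul_mul_assoc, b_mul_a, mul_smul_comm, smul_comm])
  let W := TaftDouble.stringMod n q q hq.out.pow_eq_one
  let V := W.restrict ((TaftDouble.incl n q).comp f)
  let ev : ZMod n → V.carrier → k := fun j g => g j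
  have hVa : ∀ j g, ev j (V.act (a n q) g) =
      (q ^ (j + 1).val - 1) / (q - 1) * (1 - q ^ j.val * q) * ev (j + 1) g := by
    intro j g
    change (W.act (TaftDouble.incl n q (f (a n q))) g : ZMod n → k) j = _
    rw [lift_a, TaftDouble.incl, lift_a]
    exact congrFun (TaftDouble.stringMod_a n q q _ g) j
  have hVb : ∀ j g, ev j (V.act (b n q) g) = q ^ (2 - i) * (q ^ j.val * ev j g) := by
    intro j g
    change (W.act (TaftDouble.incl n q (f (b n q))) g : ZMod n → k) j = _
    rw [lift_b, map_smul, map_smul, TaftDouble.incl, lift_b]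
    exact congrArg (q ^ (2 - i) * ·) (congrFun (TaftDouble.stringMod_b n q q _ g) j)
  have h0 := root_ne_zero n q
  have h1 : q - 1 ≠ 0 := sub_ne_zero.2 (root_ne_one n q)
  -- No coefficient of `a` on the string `n - 1, …, 1, 0` vanishes when `s = q`.
  have hne : ∀ (m : ℕ) (g : V.carrier) (j : ℕ), j + m < n → ev ((j + m : ℕ) : ZMod n) g ≠ 0 →
      ev (j : ZMod n) (V.act (a n q ^ m) g) ≠ 0 := by
    intro m
    induction m with
    | zero => intro g j _ h; rw [pow_zero, V.act_one]; exact h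
    | succ m ih =>
      intro g j hj h
      rw [RightMod.act_pow_succ, hVa]
      have e : (j : ZMod n) + 1 = ((j + 1 : ℕ) : ZMod n) := by push_cast; rfl
      have e1 := sub_ne_zero.2 (hq.out.pow_ne_one_of_pos_of_lt j.succ_ne_zero (by omega))
      rw [e, pow_val_natCast, pow_val_natCast, ← pow_succ]
      refine mul_ne_zero (mul_ne_zero (div_ne_zero e1 h1) ?_) (ih g (j + 1) (by omega) ?_)
      · rw [← neg_sub]; exact neg_ne_zero.2 e1
      · rwa [add_assoc, add_comm 1 m]
  intro h
  -- The top of the string; the twist by `q ^ (2 - i)` gives it the weight of `eᵢ`.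
  let g : V.carrier := (Pi.single ((n - 1 : ℕ) : ZMod n) 1 : ZMod n → k)
  have hg : V.act (b n q) g = q ^ (1 - i) • g := by
    refine funext fun j => (hVb j g).trans ?_
    change _ = q ^ (1 - i) * ev j g
    by_cases hj : j = ((n - 1 : ℕ) : ZMod n)
    · have : q ^ (n - 1) = q⁻¹ := by
        rw [← one_div, eq_div_iff h0, ← pow_succ, Nat.sub_add_cancel (by omega),
          hq.out.pow_eq_one]
      rw [hj, pow_val_natCast, this, ← mul_assoc, ← zpow_sub_one₀ h0]
      congr 2
      ring
    · have : ev j g = 0 := Pi.single_eq_of_ne hj _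
      rw [this, mul_zero, mul_zero, mul_zero]
  have h2 : V.act (idem n q i) g = g := by
    rw [idem_eq_rootIdem]
    refine act_rootIdem_eq_self V q hg ?_
    rw [← zpow_add₀ h0]
    simp
  have h3 := hne (n - 1) g 0 (by omega) (by simp [ev, g])
  rw [← h2, ← V.act_mul, h, map_zero] at h3
  exact h3 rfl

end Taft

/-! ### The modules `M(ℓ, i)` -/

namespace Taft

attribute [local instance] neZero_of_two_le

variable {k : Type u} [Field k] {n : ℕ} {q : k}

theorem act_a_pow_eq_zero (V : RightMod k (Taft n q)) {v : V.carrier} {l : ℕ}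
    (hv : V.act (a n q ^ l) v = 0) {i : ℕ} (hi : l ≤ i) : V.act (a n q ^ i) v = 0 := by
  rw [← Nat.add_sub_cancel' hi, pow_add, V.act_mul, hv, map_zero]

section

variable [hn : Fact (2 ≤ n)] [hq : Fact (IsPrimitiveRoot q n)]

/-- The vectors of a single string have distinct weights. -/
theorem linearIndependent_string (V : RightMod k (Taft n q)) {v : V.carrier} {t : ℤ} {l : ℕ}
    (hl : l ≤ n) (hb : V.act (b n q) v = q ^ t • v)
    (h0 : ∀ i < l, V.act (a n q ^ i) v ≠ 0) :
    LinearIndependent k fun i : Fin l => V.act (a n q ^ (i : ℕ)) v := by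
  have hq0 := root_ne_zero n q
  refine Module.End.eigenvectors_linearIndependent' (V.act (b n q))
    (fun i : Fin l => q ^ (t - (i : ℕ))) ?_ _ fun i =>
      Module.End.hasEigenvector_iff.2
        ⟨Module.End.mem_eigenspace_iff.2 (act_b_act_a_pow hq0 V hb i), h0 i i.2⟩
  intro i j hij
  have h : q ^ (i : ℕ) = q ^ (j : ℕ) := by
    simp only [zpow_sub₀ hq0, zpow_natCast] at hij
    exact inv_injective (mul_left_cancel₀ (zpow_ne_zero t hq0) (by simpa [div_eq_mul_inv] using hij))
  exact Fin.ext (hq.out.pow_inj (i.2.trans_le hl) (j.2.trans_le hl) h)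

/-- A module generated by a weight vector is spanned by the string below it. -/
theorem span_string_eq_top (V : RightMod k (Taft n q)) {v : V.carrier} {t : ℤ} {l : ℕ}
    (hb : V.act (b n q) v = q ^ t • v) (ha : V.act (a n q ^ l) v = 0)
    (hgen : ∀ x, ∃ h, V.act h v = x) :
    ⊤ ≤ Submodule.span k (Set.range fun i : Fin l => V.act (a n q ^ (i : ℕ)) v) := by
  have hq0 := root_ne_zero n q
  intro x _
  obtain ⟨h, rfl⟩ := hgen x
  have hh : h ∈ Submodule.span k (Set.range fun p : Fin n × Fin n =>
      a n q ^ (p.1 : ℕ) * b n q ^ (p.2 : ℕ)) := by rw [span_eq_top]; trivial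
  induction hh using Submodule.span_induction with
  | zero => rw [map_zero, LinearMap.zero_apply]; exact zero_mem _
  | add g h _ _ hg hh => rw [map_add, LinearMap.add_apply]; exact add_mem (hg trivial) (hh trivial)
  | smul r h _ hh => rw [map_smul, LinearMap.smul_apply]; exact Submodule.smul_mem _ _ (hh trivial)
  | mem h hh =>
    obtain ⟨⟨i, j⟩, rfl⟩ := hh
    dsimp only
    generalize (j : ℕ) = j
    rw [V.act_mul]
    induction j with
    | zero =>
      rw [pow_zero, V.act_one]
      rcases lt_or_ge (i : ℕ) l with hi | hi
      · exact Submodule.subset_span ⟨⟨i, hi⟩, rfl⟩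
      · rw [act_a_pow_eq_zero V ha hi]; exact zero_mem _
    | succ j ih =>
      rw [pow_succ', V.act_mul, act_b_act_a_pow hq0 V hb, map_smul]
      exact Submodule.smul_mem _ _ ih

/-- `M(ℓ, i)` is a single string of length `ℓ` with top weight `qⁱ`, generated by
`e_{ℓ-i+1} a^{n-ℓ}`. -/
theorem exists_top_M {l : ℕ} (hl : l ≤ n) (i : ℤ) : ∃ v : (M n q l i).carrier,
    (M n q l i).act (b n q) v = q ^ i • v ∧ (M n q l i).act (a n q ^ l) v = 0 ∧
    LinearIndependent k (fun j : Fin l => (M n q l i).act (a n q ^ (j : ℕ)) v) ∧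
    ⊤ ≤ Submodule.span k
      (Set.range fun j : Fin l => (M n q l i).act (a n q ^ (j : ℕ)) v) := by
  have hq0 := root_ne_zero n q
  have hn2 := hn.out
  set e := idem n q ((l : ℤ) - i + 1) with he
  have hspan := PJ_eq_span (n := n) (q := q) ((l : ℤ) - i + 1) (n - l)
  have hmem : e * a n q ^ (n - l) ∈ PJ n q ((l : ℤ) - i + 1) (n - l) := by
    rw [hspan]; exact Submodule.mem_span_singleton_self _
  let v : (M n q l i).carrier := (⟨e * a n q ^ (n - l), hmem⟩ : PJ n q ((l : ℤ) - i + 1) (n - l))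
  let val : (M n q l i).carrier → Taft n q := fun x =>
    @Subtype.val (Taft n q) (fun x => x ∈ PJ n q ((l : ℤ) - i + 1) (n - l)) x
  have hval : Function.Injective val := Subtype.val_injective
  have hact : ∀ h x, val ((M n q l i).act h x) = val x * h := fun h x => rfl
  have hv : val v = e * a n q ^ (n - l) := rfl
  have hb : (M n q l i).act (b n q) v = q ^ i • v := by
    refine hval ?_
    change _ = q ^ i • val v
    rw [hact, hv]
    have h1 : q ^ (n - l) • (e * a n q ^ (n - l) * b n q) =
        q ^ ((i - l : ℤ)) • (e * a n q ^ (n - l)) := by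
      rw [mul_assoc, ← mul_smul_comm, ← b_mul_a_pow, ← mul_assoc, he, idem_mul_b, smul_mul_assoc]
      congr 2
      ring
    have h2 : q ^ (n - l) = q ^ (-l : ℤ) := by
      rw [zpow_neg, zpow_natCast, ← one_div, eq_div_iff (pow_ne_zero _ hq0), ← pow_add,
        Nat.sub_add_cancel hl, hq.out.pow_eq_one]
    rw [h2, sub_eq_add_neg, add_comm, zpow_add₀ hq0, mul_smul] at h1
    exact smul_right_injective _ (zpow_ne_zero (-l : ℤ) hq0) h1
  have ha : (M n q l i).act (a n q ^ l) v = 0 := by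
    refine hval ?_
    rw [hact, hv, mul_assoc, ← pow_add, Nat.sub_add_cancel hl, a_pow, mul_zero]
    rfl
  refine ⟨v, hb, ha, linearIndependent_string _ hl hb fun m hm h => ?_,
    span_string_eq_top _ hb ha fun x => ?_⟩
  · have h1 := congrArg val h
    rw [hact, hv, mul_assoc, ← pow_add] at h1
    refine idem_mul_a_pow_ne_zero (n := n) (q := q) ((l : ℤ) - i + 1) ?_
    rw [show n - 1 = (n - l + m) + (l - 1 - m) by omega, pow_add, ← mul_assoc, ← he, h1]
    exact zero_mul _
  · have hx : val x ∈ PJ n q ((l : ℤ) - i + 1) (n - l) := Subtype.property x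
    rw [hspan] at hx
    obtain ⟨h, hh⟩ := Submodule.mem_span_singleton.1 hx
    exact ⟨h.unop, hval hh⟩

theorem cls_M_zero (i : ℤ) : GreenRing.cls (M n q 0 i) = 0 := by
  obtain ⟨v, -, -, -, h⟩ := exists_top_M (n := n) (q := q) (Nat.zero_le n) i
  have : Subsingleton (M n q 0 i).carrier := by
    refine subsingleton_of_forall_eq 0 fun x => ?_
    have := h (Submodule.mem_top (x := x))
    rwa [Set.range_eq_empty, Submodule.span_empty, Submodule.mem_bot] at this
  exact GreenRing.cls_eq_zero _

/-- A module with a basis consisting of strings is the sum of the corresponding `M(ℓ, t)`. -/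
theorem cls_eq_sum_of_strings {V : RightMod k (Taft n q)} {ι : Type} [Fintype ι] {l : ι → ℕ}
    {t : ι → ℤ} (v : ι → V.carrier) (hl : ∀ j, l j ≤ n)
    (hvb : ∀ j, V.act (b n q) (v j) = q ^ t j • v j)
    (hva : ∀ j, V.act (a n q ^ l j) (v j) = 0)
    (hv : LinearIndependent k (strings V l v))
    (hv' : ⊤ ≤ Submodule.span k (Set.range (strings V l v))) :
    GreenRing.cls V = ∑ j, GreenRing.cls (M n q (l j) (t j)) := by
  classical
  choose w hwb hwa hw hw' using fun j => exists_top_M (n := n) (q := q) (hl j) (t j)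
  let W := RightMod.pi fun j => M n q (l j) (t j)
  let x : ι → W.carrier := fun j => (Pi.single j (w j) : ∀ j, (M n q (l j) (t j)).carrier)
  have hx : ∀ h j, W.act h (x j) =
      (Pi.single j ((M n q (l j) (t j)).act h (w j)) : ∀ j, (M n q (l j) (t j)).carrier) := by
    intro h j
    refine funext fun i => ?_
    exact Pi.apply_single (fun i => (M n q (l i) (t i)).act h) (fun i => map_zero _) j (w j) i
  let B := Pi.basis (R := k) fun j => Module.Basis.mk (hw j) (hw' j)
  have hB : ⇑B = strings W l x := by
    funext p
    rw [Pi.basis_apply, Module.Basis.mk_apply]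
    exact (hx _ _).symm
  rw [← GreenRing.cls_pi]
  refine GreenRing.cls_eq_of_iso (iso_of_strings (root_ne_zero n q) v x hvb (fun j => ?_) hva
    (fun j => ?_) hv hv' (hB ▸ B.linearIndependent) (hB ▸ B.span_eq.ge))
  · rw [hx, hwb]
    exact Pi.single_smul (f := fun j => (M n q (l j) (t j)).carrier) j (q ^ t j) (w j)
  · rw [hx, hwa]
    exact Pi.single_zero (M := fun j => (M n q (l j) (t j)).carrier) j

/-- A variant of `cls_eq_sum_of_strings` where a dimension count replaces independence. -/
theorem cls_eq_sum_of_span {V : RightMod k (Taft n q)} {ι : Type} [Fintype ι] {l : ι → ℕ}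
    {t : ι → ℤ} (v : ι → V.carrier) (hl : ∀ j, l j ≤ n)
    (hvb : ∀ j, V.act (b n q) (v j) = q ^ t j • v j)
    (hva : ∀ j, V.act (a n q ^ l j) (v j) = 0)
    (hv' : ⊤ ≤ Submodule.span k (Set.range (strings V l v)))
    (hdim : ∑ j, l j = Module.finrank k V.carrier) :
    GreenRing.cls V = ∑ j, GreenRing.cls (M n q (l j) (t j)) :=
  cls_eq_sum_of_strings v hl hvb hva
    (linearIndependent_of_top_le_span_of_card_eq_finrank hv' (by simp [hdim])) hv'

theorem finrank_M {l : ℕ} (hl : l ≤ n) (i : ℤ) : Module.finrank k (M n q l i).carrier = l := by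
  obtain ⟨v, -, -, h, h'⟩ := exists_top_M (n := n) (q := q) hl i
  simpa using Module.finrank_eq_card_basis (Module.Basis.mk h h')

end

end Taft

/-! ### Tensor products -/

namespace RightMod

variable {k : Type u} {H : Type v} [Field k] [Ring H] [Bialgebra k H]

/-- The pure tensor `v ⊗ w`, as an element of the module `V ⊗ W`. -/
def tmul (V W : RightMod k H) : V.carrier →ₗ[k] W.carrier →ₗ[k] (V.tensor W).carrier :=
  TensorProduct.mk k V.carrier W.carrier

theorem top_le_of_tmul_mem {V W : RightMod k H} {ι κ : Type*} {x : ι → V.carrier}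
    {y : κ → W.carrier} (hx : ⊤ ≤ Submodule.span k (Set.range x))
    (hy : ⊤ ≤ Submodule.span k (Set.range y))
    {P : Submodule k (V.tensor W).carrier} (h : ∀ i j, V.tmul W (x i) (y j) ∈ P) : ⊤ ≤ P := by
  have h1 : Submodule.map₂ (V.tmul W) ⊤ ⊤ = ⊤ :=
    TensorProduct.map₂_mk_top_top_eq_top k V.carrier W.carrier
  rw [← h1]
  refine (Submodule.map₂_le_map₂ hx hy).trans ?_
  rw [Submodule.map₂_span_span, Submodule.span_le]
  rintro _ ⟨_, ⟨i, rfl⟩, _, ⟨j, rfl⟩, rfl⟩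
  exact h i j

theorem finrank_tensor (V W : RightMod k H) :
    Module.finrank k (V.tensor W).carrier =
      Module.finrank k V.carrier * Module.finrank k W.carrier :=
  Module.finrank_tensorProduct (R := k) (S := k) (M := V.carrier) (M' := W.carrier)

end RightMod

namespace Taft

attribute [local instance] neZero_of_two_le

variable {k : Type u} [Field k] {n : ℕ} {q : k} [hn : Fact (2 ≤ n)]
  [hq : Fact (IsPrimitiveRoot q n)]

theorem act_b_tmul (V W : RightMod k (Taft n q)) (x : V.carrier) (y : W.carrier) :
    (V.tensor W).act (b n q) (V.tmul W x y) =
      V.tmul W (V.act (b n q) x) (W.act (b n q) y) := by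
  change RightMod.act₂ V.act W.act (comulHom n q (b n q)) (x ⊗ₜ[k] y) = _
  rw [comulHom, lift_b, RightMod.act₂_tmul]
  rfl

theorem act_a_tmul (V W : RightMod k (Taft n q)) (x : V.carrier) (y : W.carrier) :
    (V.tensor W).act (a n q) (V.tmul W x y) =
      V.tmul W (V.act (a n q) x) (W.act (b n q) y) + V.tmul W x (W.act (a n q) y) := by
  change RightMod.act₂ V.act W.act (comulHom n q (a n q)) (x ⊗ₜ[k] y) = _
  rw [comulHom, lift_a, map_add, LinearMap.add_apply, RightMod.act₂_tmul, RightMod.act₂_tmul,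
    V.act_one]
  rfl

theorem act_a_pow_tmul_of_act_a_eq_zero (V W : RightMod k (Taft n q)) {x : V.carrier}
    (hx : V.act (a n q) x = 0) (y : W.carrier) (i : ℕ) :
    (V.tensor W).act (a n q ^ i) (V.tmul W x y) = V.tmul W x (W.act (a n q ^ i) y) := by
  induction i with
  | zero => rw [pow_zero, RightMod.act_one, RightMod.act_one]
  | succ i ih =>
    rw [RightMod.act_pow_succ, ih, act_a_tmul, hx, map_zero, LinearMap.zero_apply, zero_add,
      ← RightMod.act_pow_succ]

theorem act_b_tmul_of_weights (V W : RightMod k (Taft n q)) {x : V.carrier} {y : W.carrier}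
    {s t : ℤ} (hx : V.act (b n q) x = q ^ s • x) (hy : W.act (b n q) y = q ^ t • y) :
    (V.tensor W).act (b n q) (V.tmul W x y) = q ^ (s + t) • V.tmul W x y := by
  rw [act_b_tmul, hx, hy, zpow_add₀ (root_ne_zero n q), map_smul, map_smul, LinearMap.smul_apply,
    smul_smul, mul_comm]

/-- Tensoring with a one-dimensional module shifts the weights. -/
theorem cls_M_one_mul {l : ℕ} (hl : l ≤ n) (s t : ℤ) :
    GreenRing.cls (M n q 1 s) * GreenRing.cls (M n q l t) =
      GreenRing.cls (M n q l (s + t)) := by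
  have hn2 := hn.out
  have hd := finrank_M (n := n) (q := q) (show 1 ≤ n by omega) s
  have hd' := finrank_M (n := n) (q := q) hl t
  rw [← GreenRing.cls_tensor]
  have hV := exists_top_M (n := n) (q := q) (show 1 ≤ n by omega) s
  have hW := exists_top_M (n := n) (q := q) hl t
  generalize M n q 1 s = V, M n q l t = W at *
  obtain ⟨v, hvb, hva, -, hv⟩ := hV
  obtain ⟨w, hwb, hwa, -, hw⟩ := hW
  rw [pow_one] at hva
  have hpow := act_a_pow_tmul_of_act_a_eq_zero V W hva w
  have h := cls_eq_sum_of_span (V := V.tensor W) (ι := Unit) (l := fun _ => l)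
    (t := fun _ => s + t) (fun _ => V.tmul W v w) (fun _ => hl)
    (fun _ => act_b_tmul_of_weights V W hvb hwb)
    (fun _ => by rw [hpow, hwa, map_zero])
    (RightMod.top_le_of_tmul_mem hv hw fun i j => Submodule.subset_span ⟨⟨(), j⟩, by
      obtain rfl : i = 0 := Subsingleton.elim _ _
      simp only [strings, Fin.val_zero, pow_zero, RightMod.act_one]
      exact hpow j⟩)
    (by rw [RightMod.finrank_tensor, hd, hd']; simp)
  simpa using h

/-- The Clebsch–Gordan rule for tensoring with a two-dimensional module. With `v, v' = va` and
`w, wa, …` the two strings, one string of the product starts at `v ⊗ w` and the other at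
`(v ⊗ w)a - K_m (v' ⊗ w)`, where `K_m` is chosen so that the latter stops after `m` steps. -/
theorem cls_M_two_mul {m : ℕ} (hm : m + 2 ≤ n) (s t : ℤ) :
    GreenRing.cls (M n q 2 s) * GreenRing.cls (M n q (m + 1) t) =
      GreenRing.cls (M n q (m + 2) (s + t)) + GreenRing.cls (M n q m (s + t - 1)) := by
  have hq0 := root_ne_zero n q
  have hd := finrank_M (n := n) (q := q) (show 2 ≤ n by omega) s
  have hd' := finrank_M (n := n) (q := q) (show m + 1 ≤ n by omega) t
  rw [← GreenRing.cls_tensor]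
  have hV := exists_top_M (n := n) (q := q) (show 2 ≤ n by omega) s
  have hW := exists_top_M (n := n) (q := q) (show m + 1 ≤ n by omega) t
  generalize M n q 2 s = V, M n q (m + 1) t = W at *
  obtain ⟨v, hvb, hva, -, hv⟩ := hV
  obtain ⟨w, hwb, hwa, -, hw⟩ := hW
  obtain ⟨v', hv'⟩ : ∃ v', v' = V.act (a n q) v := ⟨_, rfl⟩
  have hva' : V.act (a n q) v' = 0 := by
    rw [hv', ← V.act_mul, ← pow_two, hva]
  have hvb' : V.act (b n q) v' = q ^ (s - 1) • v' := by
    have := act_b_act_a_pow hq0 V hvb 1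
    rwa [pow_one, ← hv'] at this
  have hpow := act_a_pow_tmul_of_act_a_eq_zero V W hva' w
  let K : ℕ → k := fun i => ∑ j ∈ Finset.range (i + 1), q ^ (t - j)
  -- `K m` is a multiple of a geometric sum of `m + 1 < n` powers of `q⁻¹`.
  have hK : K m ≠ 0 := by
    intro h
    have h1 : K m = q ^ t * ∑ j ∈ Finset.range (m + 1), q⁻¹ ^ j := by
      simp only [K, Finset.mul_sum, zpow_sub₀ hq0, zpow_natCast, inv_pow, div_eq_mul_inv]
    have h2 := geom_sum_mul q⁻¹ (m + 1)
    rw [h1] at h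
    rw [(mul_eq_zero.1 h).resolve_left (zpow_ne_zero _ hq0), zero_mul, eq_comm,
      sub_eq_zero] at h2
    exact hq.out.inv.pow_ne_one_of_pos_of_lt m.succ_ne_zero (by omega) h2
  obtain ⟨x, hx⟩ : ∃ x, x = V.tmul W v w := ⟨_, rfl⟩
  have hX : ∀ i, (V.tensor W).act (a n q ^ (i + 1)) x =
      V.tmul W v (W.act (a n q ^ (i + 1)) w) + K i • V.tmul W v' (W.act (a n q ^ i) w) := by
    intro i
    induction i with
    | zero =>
      rw [hx, zero_add, pow_one, act_a_tmul, hwb, pow_zero, W.act_one, map_smul, add_comm, ← hv']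
      simp [K]
    | succ i ih =>
      rw [RightMod.act_pow_succ, ih, map_add, map_smul, act_a_tmul, act_a_tmul,
        act_b_act_a_pow hq0 W hwb, hva', map_zero, LinearMap.zero_apply, zero_add,
        ← RightMod.act_pow_succ, ← RightMod.act_pow_succ, map_smul, ← hv',
        show K (i + 1) = K i + q ^ (t - (i + 1 : ℕ)) from Finset.sum_range_succ _ _, add_smul]
      abel
  obtain ⟨y, hy⟩ : ∃ y, y = (V.tensor W).act (a n q) x - K m • V.tmul W v' w := ⟨_, rfl⟩
  have hY : ∀ i, (V.tensor W).act (a n q ^ i) y =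
      (V.tensor W).act (a n q ^ (i + 1)) x - K m • V.tmul W v' (W.act (a n q ^ i) w) := by
    intro i
    rw [hy, map_sub, map_smul, ← hpow, pow_succ' _ i, RightMod.act_mul]
  have hXend : (V.tensor W).act (a n q ^ (m + 2)) x = 0 := by
    rw [hX (m + 1), act_a_pow_eq_zero W hwa (Nat.le_succ _), hwa, map_zero, map_zero, smul_zero,
      add_zero]
  have hYend : (V.tensor W).act (a n q ^ m) y = 0 := by
    rw [hY, hX, hwa, map_zero, zero_add, sub_self]
  have hxb : (V.tensor W).act (b n q) x = q ^ (s + t) • x := by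
    rw [hx]
    exact act_b_tmul_of_weights V W hvb hwb
  have hyb : (V.tensor W).act (b n q) y = q ^ (s + t - 1) • y := by
    have h1 := act_b_act_a_pow hq0 (V.tensor W) hxb 1
    have h2 := act_b_tmul_of_weights V W hvb' hwb
    rw [pow_one, Nat.cast_one] at h1
    rw [sub_add_eq_add_sub] at h2
    rw [hy, map_sub, map_smul, smul_sub, h1, h2, smul_comm]
  -- `true` indexes the string of length `m + 2`, `false` the one of length `m`.
  let l : Bool → ℕ := fun i => cond i (m + 2) m
  let top : Bool → (V.tensor W).carrier := fun i => cond i x y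
  set P := Submodule.span k (Set.range (strings (V.tensor W) l top)) with hP
  have hXP : ∀ i, (V.tensor W).act (a n q ^ i) x ∈ P := by
    intro i
    rcases lt_or_ge i (m + 2) with hi | hi
    · exact Submodule.subset_span ⟨⟨true, i, hi⟩, rfl⟩
    · rw [act_a_pow_eq_zero _ hXend hi]; exact zero_mem _
  have hYP : ∀ i, (V.tensor W).act (a n q ^ i) y ∈ P := by
    intro i
    rcases lt_or_ge i m with hi | hi
    · exact Submodule.subset_span ⟨⟨false, i, hi⟩, rfl⟩
    · rw [act_a_pow_eq_zero _ hYend hi]; exact zero_mem _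
  have h1P : ∀ i, V.tmul W v' (W.act (a n q ^ i) w) ∈ P := by
    intro i
    have h := sub_mem (hXP (i + 1)) (hYP i)
    rw [hY, sub_sub_cancel] at h
    exact (P.smul_mem_iff hK).1 h
  have h0P : ∀ i, V.tmul W v (W.act (a n q ^ i) w) ∈ P := by
    intro i
    cases i with
    | zero => simpa [W.act_one, RightMod.act_one, hx] using hXP 0
    | succ i =>
      have h := sub_mem (hXP (i + 1)) (P.smul_mem (K i) (h1P i))
      rwa [hX, add_sub_cancel_right] at h
  have h := cls_eq_sum_of_span (V := V.tensor W) (ι := Bool) (l := l)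
    (t := fun i => cond i (s + t) (s + t - 1)) top (by rintro (_ | _) <;> simp [l] <;> omega)
    (by rintro (_ | _); exacts [hyb, hxb]) (by rintro (_ | _); exacts [hYend, hXend])
    (RightMod.top_le_of_tmul_mem hv hw fun i j => by
      fin_cases i
      · simpa [V.act_one] using h0P j
      · simpa [hv'] using h1P j)
    (by
      rw [RightMod.finrank_tensor, hd, hd']
      simp [l]
      ring)
  simpa [l] using h

end Taft

/-! ### The polynomials `u_ℓ` -/

namespace Taft

attribute [local instance] neZero_of_two_le

variable {k : Type u} [Field k] {n : ℕ} {q : k} [hn : Fact (2 ≤ n)]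
  [hq : Fact (IsPrimitiveRoot q n)]

theorem cls_M_congr {l : ℕ} (hl : l ≤ n) {s t : ℤ} (h : q ^ s = q ^ t) :
    GreenRing.cls (M n q l s) = GreenRing.cls (M n q l t) := by
  have hd := finrank_M (n := n) (q := q) hl s
  obtain ⟨v, hvb, hva, -, hv⟩ := exists_top_M (n := n) (q := q) hl s
  have h := cls_eq_sum_of_span (V := M n q l s) (ι := Unit) (l := fun _ => l)
    (t := fun _ => t) (fun _ => v) (fun _ => hl) (fun _ => h ▸ hvb) (fun _ => hva)
    (hv.trans (Submodule.span_mono (by rintro _ ⟨i, rfl⟩; exact ⟨⟨(), i⟩, rfl⟩)))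
    (by simp [hd])
  simpa using h

theorem cls_M_one_zero : GreenRing.cls (M n q 1 0) = 1 := by
  have hn2 := hn.out
  let V := RightMod.unit k (Taft n q)
  let v : V.carrier := (1 : k)
  have hb : V.act (b n q) v = v := by
    change (counitHom n q (b n q)) * (1 : k) = 1
    rw [counitHom, lift_b, one_mul]
  have ha : V.act (a n q) v = 0 := by
    change (counitHom n q (a n q)) * (1 : k) = 0
    rw [counitHom, lift_a, zero_mul]
  have h := cls_eq_sum_of_span (V := V) (ι := Unit) (l := fun _ => 1)
    (t := fun _ => 0) (fun _ => v) (fun _ => by omega) (fun _ => by rw [hb, zpow_zero, one_smul])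
    (fun _ => by rw [pow_one, ha])
    (fun x _ => by
      let r : k := x
      have : x = r • v := (mul_one r).symm
      rw [this]
      exact Submodule.smul_mem _ _ (Submodule.subset_span ⟨⟨(), 0⟩, by simp only [strings, Fin.val_zero, pow_zero, V.act_one]⟩))
    (by
      have : Module.finrank k V.carrier = 1 := Module.finrank_self k
      simp [this])
  rw [← GreenRing.cls_unit]
  simpa using h.symm

theorem zpow_eq_zpow_of_dvd_sub {s t : ℤ} (h : (n : ℤ) ∣ s - t) : q ^ s = q ^ t := by
  obtain ⟨c, hc⟩ := h
  rw [eq_add_of_sub_eq hc, zpow_add₀ (root_ne_zero n q), zpow_mul, zpow_natCast,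
    hq.out.pow_eq_one, one_zpow, one_mul]

/-- Multiplication by `[M(1, n-1)]` divides the top weight by `q`. -/
theorem cls_M_one_pow_mul {l : ℕ} (hl : l ≤ n) (t : ℤ) (j : ℕ) :
    GreenRing.cls (M n q 1 ((n : ℤ) - 1)) ^ j * GreenRing.cls (M n q l t) =
      GreenRing.cls (M n q l (t - j)) := by
  induction j with
  | zero => simp
  | succ j ih =>
    rw [pow_succ', mul_assoc, ih, cls_M_one_mul hl]
    exact cls_M_congr hl (zpow_eq_zpow_of_dvd_sub (n := n) ⟨1, by push_cast; ring⟩)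

/-- The recursion `u_{ℓ+1} = x u_ℓ - α u_{ℓ-1}` is the Clebsch–Gordan rule, and
`u₀ = 0` is the class of the zero module `M(0, 0)`. -/
theorem fibPoly_eq_cls_M {l : ℕ} (hl : l ≤ n) :
    fibPoly (GreenRing.cls (M n q 1 ((n : ℤ) - 1))) (GreenRing.cls (M n q 2 0)) l =
      GreenRing.cls (M n q l 0) := by
  induction l using Nat.twoStepInduction with
  | zero => exact (cls_M_zero 0).symm
  | one => exact cls_M_one_zero.symm
  | more m h1 h2 =>
    have h := cls_M_one_pow_mul (q := q) (show m ≤ n by omega) 0 1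
    rw [pow_one] at h
    rw [fibPoly, h1 (by omega), h2 (by omega), cls_M_two_mul hl, h]
    simp

end Taft

/-! ### The module `Q` -/

namespace TaftDouble

attribute [local instance] neZero_of_two_le

variable {k : Type u} [Field k] (n : ℕ) (q : k)

theorem d_pow_mul_b (j : ℕ) : d n q ^ j * b n q = q ^ j • (b n q * d n q ^ j) := by
  induction j with
  | zero => simp
  | succ j ih =>
    rw [pow_succ', mul_assoc, ih, mul_smul_comm, ← mul_assoc, d_mul_b, smul_mul_assoc, smul_smul,
      pow_succ q, mul_assoc, ← pow_succ']

/-- The relation `da - qad = 1 - bc`, iterated. -/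
theorem d_pow_succ_mul_a (j : ℕ) : d n q ^ (j + 1) * a n q =
    q ^ (j + 1) • (a n q * d n q ^ (j + 1)) +
      (∑ i ∈ Finset.range (j + 1), q ^ i) •
        (d n q ^ j - q ^ j • (b n q * (c n q * d n q ^ j))) := by
  have h0 : d n q * a n q = q • (a n q * d n q) + (1 - b n q * c n q) := by
    rw [← d_mul_a]; abel
  have hdbc : ∀ z, d n q * (b n q * (c n q * z)) = (q * q) • (b n q * (c n q * (d n q * z))) := by
    intro z
    rw [← mul_assoc, d_mul_b, smul_mul_assoc, mul_assoc, ← mul_assoc (d n q), d_mul_c,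
      smul_mul_assoc, mul_smul_comm, smul_smul, mul_assoc (c n q)]
  induction j with
  | zero => simp [h0]
  | succ j ih =>
    rw [pow_succ' (d n q) (j + 1), mul_assoc, ih, mul_add, mul_smul_comm, mul_smul_comm, mul_sub,
      mul_smul_comm, hdbc, ← mul_assoc (d n q) (a n q), h0, add_mul, sub_mul, smul_mul_assoc,
      one_mul, ← pow_succ', Finset.sum_range_succ _ (j + 1), mul_assoc (b n q), mul_assoc (a n q),
      ← pow_succ' (d n q)]
    have hg : (q - 1) * ∑ i ∈ Finset.range (j + 1), q ^ i = q ^ (j + 1) - 1 := mul_geom_sum q _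
    generalize (∑ i ∈ Finset.range (j + 1), q ^ i) = g at *
    match_scalars
    · ring
    · ring
    · linear_combination -(q ^ (j + 1)) * hg

/-- The lengths of the strings in `Q`. On the `c`-eigenspace labelled `t`, the index `inl t` stands
for the string from `dᵗ` down to `1`, and `inr t`, which exists only for `t < n - 1`, for the string
from `dⁿ⁻¹` down to `dᵗ⁺¹`. -/
def qLen : Fin n ⊕ Fin (n - 1) → ℕ := Sum.elim (fun t => t + 1) (fun t => n - 1 - t)

/-- The `c`-label and the power of `d` of the `i`-th vector of a string. -/
def qPos : (Σ s, Fin (qLen n s)) → Fin n × Fin n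
  | ⟨.inl t, i⟩ => (t, ⟨t - i, by omega⟩)
  | ⟨.inr t, i⟩ => (⟨t, by omega⟩, ⟨n - 1 - i, by have := t.2; omega⟩)

theorem qPos_injective : Function.Injective (qPos n) := by
  rintro ⟨t | t, i, hi⟩ ⟨t' | t', i', hi'⟩ h <;>
    simp only [qPos, qLen, Sum.elim_inl, Sum.elim_inr, Prod.mk.injEq, Fin.ext_iff]
      at h hi hi'
  · obtain rfl : t = t' := Fin.ext h.1
    obtain rfl : i = i' := by omega
    rfl
  · omega
  · omega
  · obtain rfl : t = t' := Fin.ext h.1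
    obtain rfl : i = i' := by omega
    rfl

theorem qPos_surjective : Function.Surjective (qPos n) := by
  rintro ⟨t, j⟩
  rcases le_or_gt (j : ℕ) t with h | h
  · exact ⟨⟨.inl t, t - j, by simp only [qLen, Sum.elim_inl]; omega⟩,
      Prod.ext rfl (Fin.ext (by simp only [qPos]; omega))⟩
  · exact ⟨⟨.inr ⟨t, by omega⟩, n - 1 - j, by simp only [qLen, Sum.elim_inr]; omega⟩,
      Prod.ext rfl (Fin.ext (by simp only [qPos]; omega))⟩

variable [hn : Fact (2 ≤ n)]

theorem finrank_Q_le : Module.finrank k (Q n q).carrier ≤ n * n := by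
  have h := finrank_range_le_card (R := k) fun p : Fin n × Fin n =>
      (augIdeal n q).mkQ (c n q ^ (p.1 : ℕ) * d n q ^ (p.2 : ℕ))
  rw [Set.finrank, span_quotient_eq_top, finrank_top, Fintype.card_prod, Fintype.card_fin] at h
  exact h

/-- The projection of `D(R)` onto `Q`, as a `k`-linear map. -/
def toQ : TaftDouble n q →ₗ[k] (Q n q).carrier := (augIdeal n q).mkQ.restrictScalars k

theorem toQ_a_mul (z : TaftDouble n q) : toQ n q (a n q * z) = 0 := mkQ_a_mul n q z

theorem toQ_b_mul (z : TaftDouble n q) : toQ n q (b n q * z) = toQ n q z := mkQ_b_mul n q z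

theorem act_toQ (h : Taft n q) (z : TaftDouble n q) :
    (Q n q).act h (toQ n q z) = toQ n q (z * incl n q h) := rfl

/-- The class in `Q` of `F_t dʲ`, where `F_t` projects onto the eigenspace of `c` for `q⁻ᵗ`: a vector
of weight `qʲ`. -/
def qVec (t j : ℕ) : (Q n q).carrier := toQ n q (rootIdem n (q ^ t) (c n q) * d n q ^ j)

theorem act_b_qVec (t j : ℕ) : (Q n q).act (Taft.b n q) (qVec n q t j) = q ^ j • qVec n q t j := by
  rw [qVec, act_toQ, incl, Taft.lift_b, mul_assoc, d_pow_mul_b, mul_smul_comm, map_smul,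
    ← mul_assoc, (rootIdem_commute n _ (show Commute (c n q) (b n q) from (b_mul_c n q).symm)).eq,
    mul_assoc, toQ_b_mul]

theorem act_a_qVec_zero (t : ℕ) : (Q n q).act (Taft.a n q) (qVec n q t 0) = 0 := by
  rw [qVec, act_toQ, incl, Taft.lift_a, pow_zero, mul_one,
    rootIdem_mul_of_mul_eq_smul (c_mul_a n q), toQ_a_mul]

variable [hq : Fact (IsPrimitiveRoot q n)]

/-- The string through `qVec n q t` is broken exactly between `t + 1` and `t`. -/
theorem act_a_qVec_succ (t j : ℕ) : (Q n q).act (Taft.a n q) (qVec n q t (j + 1)) =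
    ((∑ i ∈ Finset.range (j + 1), q ^ i) * (1 - q ^ j * (q ^ t)⁻¹)) • qVec n q t j := by
  have ht : (q ^ t) ^ n = 1 := by rw [pow_right_comm, hq.out.pow_eq_one, one_pow]
  have ht0 : q ^ t ≠ 0 := pow_ne_zero _ (root_ne_zero n q)
  have hF : rootIdem n (q ^ t) (c n q) * c n q = (q ^ t)⁻¹ • rootIdem n (q ^ t) (c n q) := by
    rw [eq_inv_smul_iff₀ ht0, (rootIdem_commute n _ (Commute.refl (c n q))).eq,
      smul_mul_rootIdem ht (c_pow n q)]
  rw [qVec, act_toQ, incl, Taft.lift_a, mul_assoc, d_pow_succ_mul_a, mul_add, mul_smul_comm,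
    mul_smul_comm, mul_sub, mul_smul_comm, ← mul_assoc _ (a n q),
    rootIdem_mul_of_mul_eq_smul (c_mul_a n q), mul_assoc (a n q), ← mul_assoc _ (b n q),
    (rootIdem_commute n _ (show Commute (c n q) (b n q) from (b_mul_c n q).symm)).eq,
    mul_assoc (b n q), ← mul_assoc _ (c n q), hF, smul_mul_assoc, map_add, map_smul, map_smul,
    toQ_a_mul, map_sub, map_smul, toQ_b_mul, map_smul, smul_zero, zero_add, mul_smul, sub_smul, one_smul, mul_smul, qVec]

theorem exists_act_a_pow_qVec {t m j : ℕ} (ht : t < n) (hj : j < n) (hm : m ≤ j)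
    (h : ∀ i, j - m ≤ i → i < j → i ≠ t) :
    ∃ r : k, r ≠ 0 ∧ (Q n q).act (Taft.a n q ^ m) (qVec n q t j) = r • qVec n q t (j - m) := by
  have hq0 := root_ne_zero n q
  induction m with
  | zero => exact ⟨1, one_ne_zero, by rw [pow_zero, RightMod.act_one, one_smul]; rfl⟩
  | succ m ih =>
    obtain ⟨r, hr, hh⟩ := ih (by omega) fun i hi => h i (by omega)
    obtain ⟨p, hp⟩ : ∃ p, j - m = p + 1 := ⟨j - m - 1, by omega⟩
    refine ⟨r * ((∑ i ∈ Finset.range (p + 1), q ^ i) * (1 - q ^ p * (q ^ t)⁻¹)),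
      mul_ne_zero hr (mul_ne_zero (fun h0 => ?_) (fun h0 => ?_)), ?_⟩
    · have := geom_sum_mul q (p + 1)
      rw [h0, zero_mul, eq_comm, sub_eq_zero] at this
      exact hq.out.pow_ne_one_of_pos_of_lt p.succ_ne_zero (by omega) this
    · refine h p (by omega) (by omega) (hq.out.pow_inj (by omega) ht ?_)
      rwa [sub_eq_zero, eq_comm, ← div_eq_mul_inv, div_eq_one_iff_eq (pow_ne_zero _ hq0)] at h0
    · rw [RightMod.act_pow_succ, hh, map_smul, hp, act_a_qVec_succ, smul_smul,
        show j - (m + 1) = p by omega]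

/-- The linear map from `Q` to `stringMod` that sends the class of `z` to `δ₀ · z`; it is well defined
since `R` acts on the lowest weight vector `δ₀` through the counit. -/
def toStringMod (s : k) (hs : s ^ n = 1) :
    (Q n q).carrier →ₗ[k] (stringMod n q s hs).carrier :=
  (((augIdeal n q).restrictScalars k).liftQ
    ((stringMod n q s hs).act.flip (Pi.single 0 1 : ZMod n → k)) (by
      let W := stringMod n q s hs
      let δ : W.carrier := (Pi.single 0 1 : ZMod n → k)
      have hε : ∀ r : Taft n q, W.act (incl n q r) δ = Taft.counitHom n q r • δ := by
        intro r
        have h := Taft.map_act_of_generators (V := RightMod.unit k (Taft n q))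
          (W := W.restrict (incl n q)) (LinearMap.toSpanSingleton k W.carrier δ) ?_ ?_ r (1 : k)
        · change (Taft.counitHom n q r * (1 : k)) • δ = W.act (incl n q r) ((1 : k) • δ) at h
          rw [mul_one, one_smul] at h
          exact h.symm
        · intro v
          let v' : k := v
          change (Taft.counitHom n q (Taft.a n q) * v') • δ =
            W.act (incl n q (Taft.a n q)) (v' • δ)
          rw [map_smul, Taft.counitHom, Taft.lift_a, incl, Taft.lift_a, zero_mul, zero_smul]
          have : W.act (a n q) δ = 0 := by
            refine (stringMod_a n q s hs _).trans (funext fun j => ?_)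
            rw [opA_apply]
            by_cases hj : j + 1 = 0
            · rw [hj, ZMod.val_zero, pow_zero, sub_self, zero_div, zero_mul, zero_mul]; rfl
            · rw [Pi.single_eq_of_ne hj, mul_zero]; rfl
          rw [this, smul_zero]
        · intro v
          let v' : k := v
          change (Taft.counitHom n q (Taft.b n q) * v') • δ =
            W.act (incl n q (Taft.b n q)) (v' • δ)
          rw [map_smul, Taft.counitHom, Taft.lift_b, incl, Taft.lift_b, one_mul]
          have : W.act (b n q) δ = δ := by
            refine (stringMod_b n q s hs _).trans (funext fun j => ?_)
            rw [opB_apply]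
            by_cases hj : j = 0
            · simp [hj, δ]
            · have : δ j = 0 := Pi.single_eq_of_ne hj _
              rw [this, Pi.single_eq_of_ne hj, mul_zero]
          rw [this]
      intro z hz
      change W.act z δ = 0
      refine Submodule.span_induction (p := fun z _ => W.act z δ = 0) ?_ ?_ ?_ ?_ hz
      · rintro _ ⟨r, hr, rfl⟩
        rw [hε, show Taft.counitHom n q r = 0 from hr, zero_smul]
      · rw [map_zero]; rfl
      · intro x y _ _ hx hy
        rw [map_add, LinearMap.add_apply, hx, hy, add_zero]
      · intro y x _ hx
        rw [MulOpposite.smul_eq_mul_unop, W.act_mul, hx, map_zero])) ∘ₗ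
    (Submodule.Quotient.restrictScalarsEquiv k (augIdeal n q)).symm.toLinearMap

theorem toStringMod_toQ (s : k) (hs : s ^ n = 1) (z : TaftDouble n q) :
    toStringMod n q s hs (toQ n q z) =
      (stringMod n q s hs).act z (Pi.single 0 1 : ZMod n → k) := rfl

open Classical in
/-- The maps `toStringMod` separate the vectors `qVec`. -/
theorem toStringMod_qVec (s : k) (hs : s ^ n = 1) (t : ℕ) {j : ℕ} (hj : j < n) :
    toStringMod n q s hs (qVec n q t j) =
      if q ^ t * s = 1 then (Pi.single (j : ZMod n) 1 : ZMod n → k) else 0 := by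
  let W := stringMod n q s hs
  let δ : ℕ → W.carrier := fun j => (Pi.single (j : ZMod n) 1 : ZMod n → k)
  have hδ : δ 0 = (Pi.single 0 1 : ZMod n → k) := by
    simp only [δ, Nat.cast_zero]
    rfl
  have hc : W.act (c n q) (δ 0) = s • δ 0 := by
    refine (stringMod_c n q s hs _).trans (funext fun j => ?_)
    change s * opB n q (δ 0) j = s * (δ 0) j
    rw [hδ, opB_apply]
    by_cases hj : j = 0
    · simp [hj]
    · rw [Pi.single_eq_of_ne hj, mul_zero]
  have hd : ∀ j < n, W.act (d n q ^ j) (δ 0) = δ j := by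
    intro j hj
    induction j with
    | zero => rw [pow_zero, W.act_one]
    | succ j ih =>
      rw [RightMod.act_pow_succ, ih (by omega)]
      refine (stringMod_d n q s hs _).trans (funext fun i => ?_)
      rw [opD_apply]
      change (if i = 0 then 0 else (Pi.single (j : ZMod n) 1 : ZMod n → k) (i - 1)) =
        (Pi.single ((j + 1 : ℕ) : ZMod n) 1 : ZMod n → k) i
      simp only [Pi.single_apply, Nat.cast_succ, sub_eq_iff_eq_add]
      split_ifs with h0 h1
      · have h2 : ((j + 1 : ℕ) : ZMod n) = 0 := by rw [← h0, h1, Nat.cast_succ]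
        rw [ZMod.natCast_eq_zero_iff] at h2
        exact absurd (Nat.le_of_dvd j.succ_pos h2) (by omega)
      · rfl
      · rfl
      · rfl
  rw [qVec, toStringMod_toQ, ← hδ, W.act_mul]
  split_ifs with h
  · rw [act_rootIdem_eq_self W q hc h, hd j hj]
  · rw [act_rootIdem_eq_zero W hc h (by
      rw [mul_pow, pow_right_comm, hq.out.pow_eq_one, one_pow, hs, one_mul]), map_zero]
    rfl

/-- The relations of the double do not collapse `Q`: it has dimension `n²`. -/
theorem linearIndependent_qVec :
    LinearIndependent k fun p : Fin n × Fin n => qVec n q p.1 p.2 := by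
  classical
  have hq0 := root_ne_zero n q
  have hs : ∀ t : ℕ, ((q ^ t)⁻¹) ^ n = 1 := fun t => by
    rw [inv_pow, pow_right_comm, hq.out.pow_eq_one, one_pow, inv_one]
  let ψ : (Q n q).carrier →ₗ[k] (Fin n × Fin n → k) := LinearMap.pi fun p =>
    LinearMap.proj (R := k) (φ := fun _ : ZMod n => k) ((p.2 : ℕ) : ZMod n) ∘ₗ
      toStringMod n q _ (hs p.1)
  have hψ : ∀ p : Fin n × Fin n, ψ (qVec n q p.1 p.2) = Pi.single p 1 := by
    intro p
    refine funext fun r => ?_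
    change (toStringMod n q _ (hs r.1) (qVec n q p.1 p.2) : ZMod n → k) ((r.2 : ℕ) : ZMod n) = _
    rw [toStringMod_qVec _ _ _ _ _ p.2.2, Pi.single_apply, ← div_eq_mul_inv,
      div_eq_one_iff_eq (pow_ne_zero _ hq0)]
    split_ifs with h1 h2 h2
    · rw [h2, Pi.single_eq_same]
    · refine Pi.single_eq_of_ne (fun h3 => h2 (Prod.ext (Fin.ext ?_) (Fin.ext ?_))) _
      · exact (hq.out.pow_inj p.1.2 r.1.2 h1).symm
      · have := congrArg ZMod.val h3
        rwa [ZMod.val_cast_of_lt r.2.2, ZMod.val_cast_of_lt p.2.2] at this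
    · exact absurd (congrArg (fun p : Fin n × Fin n => q ^ (p.1 : ℕ)) h2.symm) h1
    · rfl
  refine LinearIndependent.of_comp ψ ?_
  have : ψ ∘ (fun p : Fin n × Fin n => qVec n q p.1 p.2) = Pi.basisFun k (Fin n × Fin n) := by
    funext p
    rw [Pi.basisFun_apply]
    exact hψ p
  rw [this]
  exact (Pi.basisFun k _).linearIndependent

/-- The tops of the strings in `Q`. -/
def qTop : Fin n ⊕ Fin (n - 1) → (Q n q).carrier :=
  Sum.elim (fun t => qVec n q t t) (fun t => qVec n q t (n - 1))

/-- The decomposition of `Q` into strings. -/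
theorem cls_Q : GreenRing.cls (Q n q) =
    ∑ t ∈ Finset.range n, GreenRing.cls (Taft.M n q (t + 1) t) +
      ∑ t ∈ Finset.range (n - 1), GreenRing.cls (Taft.M n q (n - 1 - t) ((n : ℤ) - 1)) := by
  have hn2 := hn.out
  have hstr : ∀ p : Σ s, Fin (qLen n s), ∃ r : kˣ, Taft.strings (Q n q) (qLen n) (qTop n q) p =
      r • qVec n q (qPos n p).1 (qPos n p).2 := by
    rintro ⟨t | t, i, hi⟩ <;> simp only [qLen, Sum.elim_inl, Sum.elim_inr] at hi
    · obtain ⟨r, hr, h⟩ := exists_act_a_pow_qVec n q t.2 t.2 (m := i) (by omega)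
        fun p _ hp => hp.ne
      exact ⟨Units.mk0 r hr, h⟩
    · obtain ⟨r, hr, h⟩ := exists_act_a_pow_qVec n q (t := t) (m := i) (j := n - 1) (by omega)
        (by omega) (by omega) fun p hp _ => by omega
      exact ⟨Units.mk0 r hr, h⟩
  -- Up to nonzero scalars the strings are the vectors `qVec`, each occurring once.
  choose r hr using hstr
  have hli : LinearIndependent k (Taft.strings (Q n q) (qLen n) (qTop n q)) := by
    rw [show Taft.strings (Q n q) (qLen n) (qTop n q) =
      r • ((fun p : Fin n × Fin n => qVec n q p.1 p.2) ∘ qPos n) from funext hr]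
    exact ((linearIndependent_qVec n q).comp _ (qPos_injective n)).units_smul r
  have hcard : Fintype.card (Fin n × Fin n) ≤ Fintype.card (Σ s, Fin (qLen n s)) :=
    Fintype.card_le_of_surjective _ (qPos_surjective n)
  have h := Taft.cls_eq_sum_of_strings (V := Q n q) (l := qLen n)
    (t := Sum.elim (fun t => ((t : ℕ) : ℤ)) fun _ => (n : ℤ) - 1) (qTop n q) ?_ ?_ ?_ hli ?_
  · rw [h, Fintype.sum_sum_type, Finset.sum_range, Finset.sum_range]
    rfl
  · rintro (t | t) <;> simp only [qLen, Sum.elim_inl, Sum.elim_inr] <;> omega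
  · rintro (t | t)
    · exact (act_b_qVec n q t t).trans (by rw [Sum.elim_inl, zpow_natCast]; rfl)
    · refine (act_b_qVec n q t (n - 1)).trans ?_
      rw [Sum.elim_inr, ← zpow_natCast, Nat.cast_sub (by omega), Nat.cast_one]
      rfl
  · rintro (t | t)
    · obtain ⟨r, -, h⟩ := exists_act_a_pow_qVec n q t.2 t.2 (m := t) le_rfl fun p _ hp => hp.ne
      change (Q n q).act (Taft.a n q ^ (t + 1 : ℕ)) (qVec n q t t) = 0
      rw [RightMod.act_pow_succ, h, map_smul, Nat.sub_self, act_a_qVec_zero, smul_zero]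
    · obtain ⟨r, -, h⟩ := exists_act_a_pow_qVec n q (t := t) (m := n - 1 - t - 1) (j := n - 1)
        (by omega) (by omega) (by omega) fun p hp _ => by omega
      change (Q n q).act (Taft.a n q ^ (n - 1 - t : ℕ)) (qVec n q t (n - 1)) = 0
      rw [show n - 1 - (t : ℕ) = n - 1 - t - 1 + 1 by omega, RightMod.act_pow_succ, h, map_smul,
        show n - 1 - (n - 1 - (t : ℕ) - 1) = t + 1 by omega, act_a_qVec_succ,
        mul_inv_cancel₀ (pow_ne_zero _ (root_ne_zero n q)), sub_self, mul_zero, zero_smul,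
        smul_zero]
  · refine (LinearIndependent.span_eq_top_of_card_eq_finrank' hli ?_).ge
    refine le_antisymm hli.fintype_card_le_finrank ((finrank_Q_le n q).trans ?_)
    simpa using hcard

end TaftDouble

/-! ### The class of `Q` -/

theorem corollary4p5 {k : Type*} [Field k] (n : ℕ) (q : k) [Fact (2 ≤ n)]
    [Fact (IsPrimitiveRoot q n)] (a x : GreenRing k (Taft n q))
    (ha : a = GreenRing.cls (Taft.M n q 1 ((n : ℤ) - 1)))
    (hx : x = GreenRing.cls (Taft.M n q 2 0)) :
    GreenRing.cls (TaftDouble.Q n q) =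
      1 + a + ∑ l ∈ Finset.Icc 2 (n - 1), (a ^ (n + 1 - l) + a) * fibPoly a x l
        + a * fibPoly a x n := by
  have hn2 := Fact.out (p := 2 ≤ n)
  have hfib : ∀ l ≤ n, fibPoly a x l = GreenRing.cls (Taft.M n q l 0) := fun l hl => by
    rw [ha, hx, Taft.fibPoly_eq_cls_M hl]
  -- As `αⁿ = 1`, the factor `αⁿ⁺¹⁻ˡ` moves the top weight from `1` to `qˡ⁻¹`.
  have hA : ∀ l ≤ n, a ^ (n + 1 - l) * fibPoly a x l = GreenRing.cls (Taft.M n q l (l - 1)) := by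
    intro l hl
    rw [hfib l hl, ha, Taft.cls_M_one_pow_mul hl]
    refine Taft.cls_M_congr hl (Taft.zpow_eq_zpow_of_dvd_sub (n := n) ⟨-1, ?_⟩)
    rw [Nat.cast_sub (by omega)]
    push_cast
    ring
  have hB : ∀ l ≤ n, a * fibPoly a x l = GreenRing.cls (Taft.M n q l (n - 1)) := by
    intro l hl
    have h := Taft.cls_M_one_pow_mul (q := q) hl 0 1
    rw [pow_one, ← ha] at h
    rw [hfib l hl, h]
    exact Taft.cls_M_congr hl (Taft.zpow_eq_zpow_of_dvd_sub (n := n) ⟨-1, by push_cast; ring⟩)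
  have hsum : ∑ l ∈ Finset.Icc 2 (n - 1), (a ^ (n + 1 - l) + a) * fibPoly a x l =
      ∑ l ∈ Finset.Icc 2 (n - 1), (GreenRing.cls (Taft.M n q l (l - 1)) +
        GreenRing.cls (Taft.M n q l (n - 1))) := by
    refine Finset.sum_congr rfl fun l hl => ?_
    have := (Finset.mem_Icc.1 hl).2
    rw [add_mul, hA l (by omega), hB l (by omega)]
  -- The strings `inr t` have the lengths `n - 1, …, 1`, listed in decreasing order.
  have hreflect := Finset.sum_range_reflect
    (fun t => GreenRing.cls (Taft.M n q (t + 1) ((n : ℤ) - 1))) (n - 1)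
  have hcongr : ∑ t ∈ Finset.range (n - 1), GreenRing.cls (Taft.M n q (n - 1 - t) ((n : ℤ) - 1)) =
      ∑ t ∈ Finset.range (n - 1), GreenRing.cls (Taft.M n q (n - 1 - 1 - t + 1) ((n : ℤ) - 1)) :=
    Finset.sum_congr rfl fun t ht => by
      have := Finset.mem_range.1 ht
      rw [show n - 1 - 1 - t + 1 = n - 1 - t by omega]
  have h1 : (1 : GreenRing k (Taft n q)) = GreenRing.cls (Taft.M n q 1 0) :=
    Taft.cls_M_one_zero.symm
  rw [TaftDouble.cls_Q, hcongr, hreflect, hsum, hB n le_rfl, h1, ha]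
  obtain ⟨m, rfl⟩ := Nat.exists_eq_add_of_le' hn2
  rw [show m + 2 - 1 = m + 1 from rfl, Finset.sum_range_succ, Finset.sum_range_succ' _ m,
    Finset.sum_range_succ' _ m, ← Finset.Ico_add_one_right_eq_Icc, Finset.sum_Ico_eq_sum_range,
    show m + 1 + 1 - 2 = m by omega, Finset.sum_add_distrib]
  have e1 : ∀ t : ℕ, Taft.M (m + 2) q (2 + t) (((2 + t : ℕ) : ℤ) - 1) =
      Taft.M (m + 2) q (t + 1 + 1) ((t + 1 : ℕ) : ℤ) := fun t => by
    congr 1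
    · omega
    · push_cast; ring
  have e2 : ∀ t : ℕ, Taft.M (m + 2) q (2 + t) (((m + 2 : ℕ) : ℤ) - 1) =
      Taft.M (m + 2) q (t + 1 + 1) (((m + 2 : ℕ) : ℤ) - 1) := fun t => by
    congr 1
    omega
  have e3 : Taft.M (m + 2) q (m + 2) (((m + 2 : ℕ) : ℤ) - 1) =
      Taft.M (m + 2) q (m + 1 + 1) ((m + 1 : ℕ) : ℤ) := by
    congr 1
    push_cast; ring
  simp only [e1, e2, e3, zero_add, Nat.cast_zero]
  abel
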